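/- Fix $q\in\mathbb{C}$ with $0<|q|<1$ and put $T_xf(x)=f(qx)$, $(x)_\infty=\prod_{k\ge0}(1-xq^k)$, $[\lambda]=\frac{1-q^\lambda}{1-q}$. Consider systems $T_xy=A(x)y$ with labelled parameters $e_1,\dots,e_9,\kappa\in\mathbb{C}$, where $$A(x)=I+A^{(1)}x+A^{(2)}x^2+\kappa I x^3\ (3\times3),\qquad \det A(x)=\kappa^3\prod_{i=1}^9(x+e_i),\qquad e_i\ne e_j\ (i\neq j).$$ For $1\le i\le 8$ let $s_i$ be the transposition $e_i\leftrightarrow e_{i+1}$ of the parameters. Two systems are equivalent, $A\simeq A'$, if they have the same parameters and $G^{-1}A(x)G=A'(x)$ for all $x$ with a constant $G\in GL(3,\mathbb{C})$. *The $q$-middle convolution.* For a tuple $(B_1,\dots,B_N)$ of endomorphisms of $V$ let $G_i$ be the endomorphism of $V^N$ whose $i$-th block row is $(q^\lambda B_1,\dots,q^\lambda B_i+[\lambda]I,\dots,q^\lambda B_N)$ and whose other block rows are $0$. The subspaces $\mathcal K=\bigoplus_i\mathrm{Ker}\,B_i$ and $\mathcal L=\mathrm{Ker}(G_1+\dots+G_N)$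 are invariant, and $mc_\lambda(B_1,\dots,B_N)$ is the tuple $(\bar G_1,\dots,\bar G_N)$ induced on $V^N/(\mathcal K+\mathcal L)$. *The transformation $s_0=g^{-1}\circ mc_\lambda\circ g$.* Put $g(x)=(-x/e_1)_\infty(-x/e_2)_\infty(-x/e_3)_\infty$ and $q^\lambda=(\kappa e_1e_2e_3)^{-1}$. The gauge transformation by $g$ turns $A$ into $A'(x)=\frac{g(qx)}{g(x)}A(x)=\frac{A(x)}{(1+x/e_1)(1+x/e_2)(1+x/e_3)}$; let $A_1,A_2,A_3$ be the constant matrices with $\sum_{i=1}^3\frac{A_i}{x+e_i}=\frac{I-A'(x)}{(1-q)x}$. Let $(\bar G_1,\bar G_2,\bar G_3)=mc_\lambda(A_1,A_2,A_3)$, written as $3\times 3$ matrices in some basis of the quotient space. Then $s_0.A=\tilde A$ with $$\tilde A(x)=(1+x/e_1)(1+x/e_2)(1+x/e_3)\Big[I-(1-q)x\sum_{i=1}^3\frac{\bar G_i}{x+e_i}\Big],$$ with parameters $\tilde e_i=e_i$ $(i\le3)$, $\tilde e_i=\kappa e_1e_2e_3e_i$ $(i\ge4)$, $\tilde\kappa=\kappa^{-1}(e_1e_2e_3)^{-2}$.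 *Proposition.* Let $A$ be such a system with $\kappa e_ie_je_k\ne1$ for all pairwise distinct $i,j,k$, and assume that $(A_1,A_2,A_3)$ satisfies, for all $j\in\{1,2,3\}$ and $\tau\in\mathbb{C}$, $$(\ast)\ \bigcap_{i\ne j}\mathrm{Ker}\,A_i\cap\mathrm{Ker}(A_j+\tau)=\{0\},\qquad(\ast\ast)\ \sum_{i\neq j}\mathrm{Im}\,A_i+\mathrm{Im}(A_j+\tau)=\mathbb{C}^3 .$$ Then the quotient space is three-dimensional, $s_0.A$ is again a system of the above form (with the parameters $\tilde e_i$, $\tilde\kappa$), its class under $\simeq$ depends only on the class of $A$, and $$s_0.s_i.A\simeq s_i.s_0.A\quad(1\le i\le 8,\ i\neq3),\qquad s_0.s_0.A\simeq A .$$ Moreover $s_0$ is birational up to conjugation: $s_0$ is its own inverse up to $\simeq$, and near $A$, as well as near $s_0.A$, it is given by rational functions of the entries of $A^{(1)},A^{(2)}$ and of $e_1,\dots,e_9,\kappa$: there are rational functions, regular at the given system, which compute a representative of $s_0.A'$ for every system $A'$ of the above form, with $\kappa' e_i'e_j'e_k'\neq1$ for pairwise distinct $i,j,k$, at which they are regular.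 -/

import Mathlib

noncomputable section

namespace QE8

open Polynomial

/-! ### The `q`-middle convolution of a tuple of endomorphisms -/

section MiddleConvolution

variable {ι V : Type*} [Fintype ι] [DecidableEq ι] [AddCommGroup V] [Module ℂ V]

/-- The `q`-number `[λ] = (1 - q ^ λ) / (1 - q)`. -/
def qNumber (q lam : ℂ) : ℂ := (1 - q ^ lam) / (1 - q)

/-- The `q`-convolution `c_λ : (B_i) ↦ (G_i)` on `V ^ N`: the `i`-th block row of `G_i` is
`(q^λ B_1, …, q^λ B_i + [λ] I, …, q^λ B_N)` and all the other block rows vanish. -/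
def qConv (q lam : ℂ) (B : ι → Module.End ℂ V) (i : ι) : Module.End ℂ (ι → V) :=
  LinearMap.single ℂ (fun _ : ι => V) i ∘ₗ
    ((∑ j, q ^ lam • (B j ∘ₗ LinearMap.proj j)) + qNumber q lam • LinearMap.proj i)

/-- `𝒦 = Ker B_1 ⊕ ⋯ ⊕ Ker B_N`. -/
def mcK (B : ι → Module.End ℂ V) : Submodule ℂ (ι → V) :=
  Submodule.pi Set.univ fun i => LinearMap.ker (B i)

/-- `ℒ = Ker (G_1 + ⋯ + G_N)`. -/
def mcL (q lam : ℂ) (B : ι → Module.End ℂ V) : Submodule ℂ (ι → V) :=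
  LinearMap.ker (∑ i, qConv q lam B i)

theorem qConv_apply (q lam : ℂ) (B : ι → Module.End ℂ V) (i : ι) (v : ι → V) :
    qConv q lam B i v =
      Pi.single i ((∑ j, q ^ lam • B j (v j)) + qNumber q lam • v i) := by
  simp [qConv]

theorem mcK_le_comap (q lam : ℂ) (B : ι → Module.End ℂ V) (i : ι) :
    mcK B ≤ (mcK B).comap (qConv q lam B i) := by
  intro v hv
  have hv' : ∀ j, B j (v j) = 0 := fun j => by
    simpa using (Submodule.mem_pi.1 hv) j (Set.mem_univ j)
  rw [Submodule.mem_comap, qConv_apply]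
  refine Submodule.mem_pi.2 fun j _ => ?_
  rw [LinearMap.mem_ker]
  by_cases h : j = i
  · subst h
    simp [hv']
  · simp [Pi.single_eq_of_ne h]

theorem mcL_le_comap (q lam : ℂ) (B : ι → Module.End ℂ V) (i : ι) :
    mcL q lam B ≤ (mcL q lam B).comap (qConv q lam B i) := by
  intro v hv
  have h0 : qConv q lam B i v = 0 := by
    have h := congrFun (LinearMap.mem_ker.1 hv) i
    simp only [LinearMap.sum_apply, Finset.sum_apply, qConv_apply, Pi.single_apply,
      Finset.sum_ite_eq, Finset.mem_univ, if_true, Pi.zero_apply] at h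
    rw [qConv_apply, h, Pi.single_zero]
  rw [Submodule.mem_comap, h0]
  exact Submodule.zero_mem _

theorem mc_le_comap (q lam : ℂ) (B : ι → Module.End ℂ V) (i : ι) :
    mcK B ⊔ mcL q lam B ≤ (mcK B ⊔ mcL q lam B).comap (qConv q lam B i) :=
  sup_le ((mcK_le_comap q lam B i).trans (Submodule.comap_mono le_sup_left))
    ((mcL_le_comap q lam B i).trans (Submodule.comap_mono le_sup_right))

/-- The space `V ^ N / (𝒦 + ℒ)` on which the `q`-middle convolution acts. -/
abbrev MCSpace (q lam : ℂ) (B : ι → Module.End ℂ V) : Type _ :=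
  (ι → V) ⧸ (mcK B ⊔ mcL q lam B)

/-- The `q`-middle convolution `mc_λ : (B_i) ↦ (Ḡ_i)`, the tuple induced by `(G_i)` on
`V ^ N / (𝒦 + ℒ)`. -/
def qMC (q lam : ℂ) (B : ι → Module.End ℂ V) (i : ι) : Module.End ℂ (MCSpace q lam B) :=
  Submodule.mapQ _ _ (qConv q lam B i) (mc_le_comap q lam B i)

/-- Condition `(∗)`. -/
def Star (B : ι → Module.End ℂ V) : Prop :=
  ∀ (j : ι) (τ : ℂ),
    (⨅ i ∈ {i : ι | i ≠ j}, LinearMap.ker (B i)) ⊓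
      LinearMap.ker (B j + τ • (1 : Module.End ℂ V)) = ⊥

/-- Condition `(∗∗)`. -/
def StarStar (B : ι → Module.End ℂ V) : Prop :=
  ∀ (j : ι) (τ : ℂ),
    (⨆ i ∈ {i : ι | i ≠ j}, LinearMap.range (B i)) ⊔
      LinearMap.range (B j + τ • (1 : Module.End ℂ V)) = ⊤

end MiddleConvolution

/-! ### The rank three systems -/

/-- A system `T_x y = A(x) y` of rank three with polynomial coefficients, together with its
labelled parameters. The parameter `e_i` of the text is `e (i - 1)`. -/
structure QSystem where
  e : Fin 9 → ℂ
  κ : ℂ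
  A : Matrix (Fin 3) (Fin 3) ℂ[X]

namespace QSystem

/-- The value `A(x)`. -/
def at' (d : QSystem) (x : ℂ) : Matrix (Fin 3) (Fin 3) ℂ := d.A.map (Polynomial.eval x)

/-- `A = I + A⁽¹⁾ x + A⁽²⁾ x² + κ I x³` and `det A = κ³ ∏ (x + e_i)` with distinct `e_i`.
(Taking `x = 0` shows that `κ` and all the `e_i` are nonzero.) -/
structure IsE8 (d : QSystem) : Prop where
  form : ∃ A₁ A₂ : Matrix (Fin 3) (Fin 3) ℂ, ∀ x : ℂ,
    d.at' x = 1 + x • A₁ + x ^ 2 • A₂ + (d.κ * x ^ 3) • (1 : Matrix (Fin 3) (Fin 3) ℂ)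
  det_eq : ∀ x : ℂ, (d.at' x).det = d.κ ^ 3 * ∏ i, (x + d.e i)
  distinct : Function.Injective d.e

/-- `κ e_i e_j e_k ≠ 1` for pairwise distinct `i, j, k`. -/
def NonResonant (d : QSystem) : Prop :=
  ∀ i j k : Fin 9, i ≠ j → j ≠ k → k ≠ i → d.κ * d.e i * d.e j * d.e k ≠ 1

/-- Conjugation by a constant matrix in `GL(3)`, with the same parameters. -/
def Conj (a b : QSystem) : Prop :=
  a.e = b.e ∧ a.κ = b.κ ∧
    ∃ G : GL (Fin 3) ℂ, ∀ x : ℂ,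
      (↑G⁻¹ : Matrix (Fin 3) (Fin 3) ℂ) * a.at' x * (G : Matrix (Fin 3) (Fin 3) ℂ) = b.at' x

/-- The transposition `e_{i+1} ↔ e_{i+2}` of the parameters, for `i = 0, …, 7`; this is
`s_{i+1}`. -/
def swap (i : Fin 8) (d : QSystem) : QSystem :=
  { d with e := d.e ∘ Equiv.swap i.castSucc i.succ }

/-- The parameters `e_1, e_2, e_3`. -/
def e₃ (d : QSystem) (i : Fin 3) : ℂ := d.e (Fin.castLE (by norm_num) i)

/-- The product `e_1 e_2 e_3`. -/
def prod₃ (d : QSystem) : ℂ := ∏ i, d.e₃ i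

end QSystem

/-- `(x)_∞ = ∏_{k ≥ 0} (1 - x q^k)`. -/
def qPoch (q x : ℂ) : ℂ := ∏' k : ℕ, (1 - x * q ^ k)

/-- `g = (-x/e_1)_∞ (-x/e_2)_∞ (-x/e_3)_∞`. -/
def gaugeFun (q : ℂ) (d : QSystem) (x : ℂ) : ℂ := ∏ i, qPoch q (-x / d.e₃ i)

/-- The gauge transformation `y ↦ g y` takes `T_x y = A y` to `T_x y = (g(qx) / g(x)) A y`. -/
def gauge (q : ℂ) (g : ℂ → ℂ) (A : ℂ → Matrix (Fin 3) (Fin 3) ℂ) (x : ℂ) :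
    Matrix (Fin 3) (Fin 3) ℂ :=
  (g (q * x) / g x) • A x

/-- The constant matrices `A_1, A_2, A_3` with `∑ A_i / (x + e_i) = (I - A') / ((1 - q) x)`,
where `A'` is the gauge transform of `A` by `g`. -/
def IsResidueTuple (q : ℂ) (d : QSystem) (B : Fin 3 → Matrix (Fin 3) (Fin 3) ℂ) : Prop :=
  ∀ x : ℂ, x ≠ 0 → gaugeFun q d x ≠ 0 →
    ∑ i, (x + d.e₃ i)⁻¹ • B i = ((1 - q) * x)⁻¹ • (1 - gauge q (gaugeFun q d) d.at' x)

/-- The matrix `I - (1 - q) x ∑ C_i / (x + e_i)`: the system `D_x y = ∑ C_i / (x + e_i) y`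
rewritten with `T_x`. -/
def fuchsMatrix (q : ℂ) (d : QSystem) (C : Fin 3 → Matrix (Fin 3) (Fin 3) ℂ) (x : ℂ) :
    Matrix (Fin 3) (Fin 3) ℂ :=
  1 - ((1 - q) * x) • ∑ i, (x + d.e₃ i)⁻¹ • C i

/-- `b` is the transform `s_0 . d = (g⁻¹ ∘ mc_λ ∘ g) . d`, where `q ^ λ = (κ e_1 e_2 e_3)⁻¹`.
The middle convolution lives on a quotient space, and `ψ` is the basis of that space
in which it is written as a tuple of `3 × 3` matrices; the parameters are transformed by
`e_i ↦ e_i` for `i ≤ 3`, `e_i ↦ κ e_1 e_2 e_3 e_i` for `i > 3`, and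
`κ ↦ κ⁻¹ (e_1 e_2 e_3)⁻²`. -/
def IsS0 (q : ℂ) (d b : QSystem) : Prop :=
  (∀ i : Fin 9, b.e i = if (i : ℕ) < 3 then d.e i else d.κ * d.prod₃ * d.e i) ∧
  b.κ = (d.κ * d.prod₃ ^ 2)⁻¹ ∧
  ∃ (B : Fin 3 → Matrix (Fin 3) (Fin 3) ℂ) (lam : ℂ)
    (ψ : MCSpace q lam (fun i => Matrix.toLin' (B i)) ≃ₗ[ℂ] (Fin 3 → ℂ)),
    IsResidueTuple q d B ∧
    q ^ lam = (d.κ * d.prod₃)⁻¹ ∧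
    ∀ x : ℂ, gaugeFun q d x ≠ 0 →
      b.at' x = gauge q (fun z => (gaugeFun q d z)⁻¹)
        (fuchsMatrix q d fun i =>
          LinearMap.toMatrix' (ψ.conj (qMC q lam (fun i => Matrix.toLin' (B i)) i))) x

/-! ### Rationality of `s_0` -/

/-- The coordinates of a system: the entries of `A⁽¹⁾` and `A⁽²⁾`, the `e_i`, and `κ`. -/
abbrev Coord : Type := (Fin 2 × Fin 3 × Fin 3) ⊕ Fin 9 ⊕ Unit

def QSystem.coord (d : QSystem) : Coord → ℂ
  | .inl (k, i, j) => (d.A i j).coeff ((k : ℕ) + 1)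
  | .inr (.inl i) => d.e i
  | .inr (.inr _) => d.κ

/-- `s_0` is given near `d` by rational functions of the coordinates: there are rational
functions `P_v / Δ`, regular at `d`, that compute a representative of `s_0 . d'` for all
`d'` at which they are regular. -/
def S0RationalAt (q : ℂ) (d : QSystem) : Prop :=
  ∃ (P : Coord → MvPolynomial Coord ℂ) (Δ : MvPolynomial Coord ℂ),
    MvPolynomial.eval d.coord Δ ≠ 0 ∧
    ∀ d' : QSystem, d'.IsE8 → d'.NonResonant → MvPolynomial.eval d'.coord Δ ≠ 0 →
      ∃ b : QSystem, b.IsE8 ∧ IsS0 q d' b ∧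
        ∀ v, b.coord v = MvPolynomial.eval d'.coord (P v) / MvPolynomial.eval d'.coord Δ

end QE8

end

/-!
Since `∏ (1 + x / e_i) A' = A` is polynomial, `A` is determined by the residues `A_1, A_2, A_3`,
and its leading coefficient gives `q^λ ∑ A_i = -[λ] I`. By this identity `𝒦 + ℒ` is the kernel of
the block map `v ↦ (A_i (row_i v))_i`, where `A_i row_i` is the nonzero block row of `G_i`, so
that `mc_λ` acts on the image of this map. The zeros of `det A` are simple, hence `Ker A_i` is a
line, and the dimension is `9 - 3 - 3`.

If `v` is killed by `A(x)`, the convolution turns it into a vector killed by the new system at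
`q^{-λ} x`; this moves the zeros `-e_i`, `i ≥ 4`, to their new places. Everything is natural under
conjugation and permutation of the residues, which gives the relations with `s_i`, `i ≠ 3`.
Summing the diagonal blocks of the embedded quotient inverts the construction under `(∗)` and
`(∗∗)`. Finally, two constant linear maps into and out of `V^3` that identify the image with `ℂ^3`
at one system do so near it, and Cramer's rule makes the transformed tuple rational.
-/

noncomputable section

namespace QE8

open Polynomial Module Matrix

theorem ne_one_of_norm_lt_one {R : Type*} [Norm R] [One R] [NormOneClass R] {x : R}
    (hx : ‖x‖ < 1) : x ≠ 1 := fun h => by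
  rw [h, norm_one] at hx
  exact lt_irrefl _ hx

section Gauge

variable {q : ℂ}

theorem summable_norm_neg_mul_pow (hq : ‖q‖ < 1) (y : ℂ) :
    Summable fun k : ℕ => ‖-(y * q ^ k)‖ := by
  simpa only [norm_neg, norm_mul, norm_pow] using
    (summable_geometric_of_lt_one (norm_nonneg q) hq).mul_left ‖y‖

theorem multipliable_qPoch (hq : ‖q‖ < 1) (y : ℂ) : Multipliable fun k : ℕ => 1 - y * q ^ k := by
  simpa only [sub_eq_add_neg] using
    multipliable_one_add_of_summable (summable_norm_neg_mul_pow hq y)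

theorem qPoch_eq_mul (hq : ‖q‖ < 1) (y : ℂ) : qPoch q y = (1 - y) * qPoch q (q * y) := by
  have hshift (k : ℕ) : y * q ^ (k + 1) = q * y * q ^ k := by ring
  have h := tprod_eq_zero_mul' (f := fun k : ℕ => 1 - y * q ^ k)
    (by simpa only [hshift] using multipliable_qPoch hq (q * y))
  simpa only [qPoch, pow_zero, mul_one, hshift] using h

theorem qPoch_ne_zero (hq : ‖q‖ < 1) {y : ℂ} (hy : ‖y‖ < 1) : qPoch q y ≠ 0 := by
  have hne (k : ℕ) : 1 + -(y * q ^ k) ≠ 0 := by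
    rw [← sub_eq_add_neg]
    refine sub_ne_zero.2 (ne_one_of_norm_lt_one ?_).symm
    rw [norm_mul, norm_pow]
    exact mul_lt_one_of_nonneg_of_lt_one_left (norm_nonneg _) hy
      (pow_le_one₀ (norm_nonneg _) hq.le)
  simpa only [qPoch, sub_eq_add_neg] using
    tprod_one_add_ne_zero_of_summable hne (summable_norm_neg_mul_pow hq y)

theorem gaugeFun_eq_mul (hq : ‖q‖ < 1) (d : QSystem) (x : ℂ) :
    gaugeFun q d x = (∏ i, (1 + x / d.e₃ i)) * gaugeFun q d (q * x) := by
  unfold gaugeFun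
  rw [← Finset.prod_mul_distrib]
  refine Finset.prod_congr rfl fun i _ => ?_
  rw [qPoch_eq_mul hq]
  congr 2 <;> ring

theorem infinite_setOf_gaugeFun_ne_zero (hq : ‖q‖ < 1) {d : QSystem} (he : ∀ i, d.e₃ i ≠ 0) :
    {x : ℂ | x ≠ 0 ∧ gaugeFun q d x ≠ 0}.Infinite := by
  have hnear : {x : ℂ | ∀ i, ‖x‖ < ‖d.e₃ i‖} ∈ nhds (0 : ℂ) :=
    Filter.eventually_all.2 fun i =>
      continuousAt_id.norm.eventually_lt_const (by simpa using he i)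
  refine ((infinite_of_mem_nhds 0 hnear).sdiff (Set.finite_singleton 0)).mono
    fun x hx => ⟨hx.2, Finset.prod_ne_zero_iff.2 fun i _ => qPoch_ne_zero hq ?_⟩
  rw [norm_div, norm_neg]
  exact (div_lt_one (norm_pos_iff.2 (he i))).2 (hx.1 i)

end Gauge

section PolynomialMatrices

variable {K n : Type*} [Field K]

theorem eq_of_infinite_map_eval_eq {M N : Matrix n n K[X]} {s : Set K} (hs : s.Infinite)
    (h : ∀ x ∈ s, M.map (eval x) = N.map (eval x)) : M = N :=
  Matrix.ext fun i j => Polynomial.eq_of_infinite_eval_eq _ _ <|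
    hs.mono fun x hx => congrFun (congrFun (h x hx) i) j

theorem eval_det_eq_det_map_eval [Fintype n] [DecidableEq n] (M : Matrix n n K[X]) (x : K) :
    M.det.eval x = (M.map (eval x)).det :=
  RingHom.map_det (evalRingHom x) M

end PolynomialMatrices

section FuchsPoly

variable {K ι n : Type*} [Field K] [Fintype ι] {q : K} {e : ι → K}

/-- The polynomial `∏ (1 + x / e_i)`, by which a solution `g` of `g(qx) ∏ (1 + x / e_i) = g(x)`
transforms a `q`-difference system. -/
def gaugePoly (e : ι → K) : K[X] := ∏ i, (1 + C (e i)⁻¹ * X)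

theorem natDegree_one_add_C_mul_X_le (a : K) : (1 + C a * X).natDegree ≤ 1 :=
  natDegree_add_le_of_degree_le (natDegree_one.trans_le zero_le_one)
    ((natDegree_C_mul_le a X).trans natDegree_X_le)

theorem coeff_one_one_add_C_mul_X (a : K) : (1 + C a * X).coeff 1 = a := by
  simp [coeff_one]

theorem eval_gaugePoly (e : ι → K) (x : K) : (gaugePoly e).eval x = ∏ i, (1 + x / e i) := by
  simp [gaugePoly, eval_prod, div_eq_inv_mul]

theorem eval_zero_gaugePoly (e : ι → K) : (gaugePoly e).eval 0 = 1 := by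
  simp [eval_gaugePoly]

theorem eval_neg_gaugePoly {i : ι} (hi : e i ≠ 0) : (gaugePoly e).eval (-e i) = 0 := by
  rw [eval_gaugePoly]
  exact Finset.prod_eq_zero (Finset.mem_univ i) (by rw [neg_div, div_self hi, add_neg_cancel])

theorem eval_gaugePoly_ne_zero (he : ∀ i, e i ≠ 0) {x : K} (hx : ∀ i, x + e i ≠ 0) :
    (gaugePoly e).eval x ≠ 0 := by
  rw [eval_gaugePoly]
  refine Finset.prod_ne_zero_iff.2 fun i _ h => hx i ?_
  rw [one_add_div (he i), div_eq_zero_iff, or_iff_left (he i)] at h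
  rw [add_comm, h]

theorem natDegree_gaugePoly_le (e : ι → K) : (gaugePoly e).natDegree ≤ Fintype.card ι := by
  refine (natDegree_prod_le _ _).trans ((Finset.sum_le_card_nsmul _ _ 1 fun i _ =>
    natDegree_one_add_C_mul_X_le _).trans_eq ?_)
  rw [smul_eq_mul, mul_one, Finset.card_univ]

theorem coeff_card_gaugePoly (e : ι → K) :
    (gaugePoly e).coeff (Fintype.card ι) = (∏ i, e i)⁻¹ := by
  have h := coeff_prod_of_natDegree_le Finset.univ (fun i => 1 + C (e i)⁻¹ * X) 1
    fun i _ => natDegree_one_add_C_mul_X_le _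
  simpa only [gaugePoly, coeff_one_one_add_C_mul_X, Finset.card_univ, mul_one,
    Finset.prod_inv_distrib] using h

variable [DecidableEq ι]

/-- The polynomial `∏ (1 + x / e_j) / (x + e_i)`. -/
def gaugeCofactor (e : ι → K) (i : ι) : K[X] :=
  C (e i)⁻¹ * ∏ j ∈ Finset.univ.erase i, (1 + C (e j)⁻¹ * X)

/-- The factor by which the value of `fuchsPoly` at `-e_i` differs from the residue `M_i`. -/
def residueFactor (q : K) (e : ι → K) (i : ι) : K :=
  (1 - q) * ∏ j ∈ Finset.univ.erase i, (1 - e i / e j)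

theorem eval_gaugeCofactor (e : ι → K) (i : ι) (x : K) :
    (gaugeCofactor e i).eval x = (e i)⁻¹ * ∏ j ∈ Finset.univ.erase i, (1 + x / e j) := by
  simp [gaugeCofactor, eval_prod, div_eq_inv_mul]

theorem eval_gaugeCofactor_of_add_ne_zero {i : ι} (hi : e i ≠ 0) {x : K} (hx : x + e i ≠ 0) :
    (gaugeCofactor e i).eval x = (gaugePoly e).eval x * (x + e i)⁻¹ := by
  rw [eval_gaugeCofactor, eval_gaugePoly, ← Finset.mul_prod_erase _ _ (Finset.mem_univ i)]
  field_simp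
  ring

theorem eval_neg_gaugeCofactor_of_ne {i j : ι} (hi : e i ≠ 0) (hij : i ≠ j) :
    (gaugeCofactor e j).eval (-e i) = 0 := by
  rw [eval_gaugeCofactor, Finset.prod_eq_zero (Finset.mem_erase.2 ⟨hij, Finset.mem_univ i⟩)
    (by rw [neg_div, div_self hi, add_neg_cancel]), mul_zero]

theorem natDegree_gaugeCofactor_lt (e : ι → K) (i : ι) :
    (gaugeCofactor e i).natDegree < Fintype.card ι := by
  refine ((natDegree_C_mul_le _ _).trans ((natDegree_prod_le _ _).trans
    (Finset.sum_le_card_nsmul _ _ 1 fun i _ => natDegree_one_add_C_mul_X_le _))).trans_lt ?_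
  rw [smul_eq_mul, mul_one]
  exact Finset.card_erase_lt_of_mem (Finset.mem_univ i)

theorem coeff_gaugeCofactor (e : ι → K) (i : ι) {k : ℕ} (hk : Fintype.card ι = k + 1) :
    (gaugeCofactor e i).coeff k = (∏ i, e i)⁻¹ := by
  have h := coeff_prod_of_natDegree_le (Finset.univ.erase i) (fun i => 1 + C (e i)⁻¹ * X) 1
    fun i _ => natDegree_one_add_C_mul_X_le _
  rw [Finset.card_erase_of_mem (Finset.mem_univ i), Finset.card_univ, hk, Nat.add_sub_cancel,
    mul_one] at h
  rw [gaugeCofactor, coeff_C_mul, h, ← Finset.mul_prod_erase _ _ (Finset.mem_univ i)]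
  simp only [coeff_one_one_add_C_mul_X, mul_inv, Finset.prod_inv_distrib]

theorem residueFactor_ne_zero (hq : q ≠ 1) (hinj : Function.Injective e) (he : ∀ i, e i ≠ 0)
    (i : ι) : residueFactor q e i ≠ 0 := by
  refine mul_ne_zero (sub_ne_zero.2 hq.symm) (Finset.prod_ne_zero_iff.2 fun j hj => ?_)
  rw [sub_ne_zero, ne_comm, Ne, div_eq_one_iff_eq (he j)]
  exact hinj.ne (Finset.ne_of_mem_erase hj).symm

variable [DecidableEq n]

/-- The polynomial matrix `∏ (1 + x / e_i) (I - (1 - q) x ∑ M_i / (x + e_i))` of the Fuchsian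
`q`-difference system with residues `M_i` at `-e_i`, after the gauge transformation that clears
its denominators. -/
def fuchsPoly (q : K) (e : ι → K) (M : ι → Matrix n n K) : Matrix n n K[X] :=
  gaugePoly e • 1 - (C (1 - q) * X) • ∑ i, gaugeCofactor e i • (M i).map C

theorem fuchsPoly_apply (q : K) (e : ι → K) (M : ι → Matrix n n K) (a b : n) :
    fuchsPoly q e M a b = gaugePoly e * C ((1 : Matrix n n K) a b) -
      C (1 - q) * X * ∑ i, gaugeCofactor e i * C (M i a b) := by
  simp [fuchsPoly, Matrix.sum_apply, Matrix.one_apply, apply_ite C]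

theorem map_eval_fuchsPoly (q : K) (e : ι → K) (M : ι → Matrix n n K) (x : K) :
    (fuchsPoly q e M).map (eval x) =
      (gaugePoly e).eval x • 1 - ((1 - q) * x) • ∑ i, (gaugeCofactor e i).eval x • M i := by
  ext a b
  simp [fuchsPoly_apply, Matrix.sum_apply, eval_finsetSum]

theorem map_eval_fuchsPoly_of_add_ne_zero (he : ∀ i, e i ≠ 0) (M : ι → Matrix n n K) {x : K}
    (hx : ∀ i, x + e i ≠ 0) :
    (fuchsPoly q e M).map (eval x) =
      (gaugePoly e).eval x • (1 - ((1 - q) * x) • ∑ i, (x + e i)⁻¹ • M i) := by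
  simp only [map_eval_fuchsPoly, eval_gaugeCofactor_of_add_ne_zero (he _) (hx _), mul_smul,
    ← Finset.smul_sum, smul_sub]
  rw [smul_comm x, smul_comm (1 - q)]

theorem map_eval_zero_fuchsPoly (q : K) (e : ι → K) (M : ι → Matrix n n K) :
    (fuchsPoly q e M).map (eval 0) = 1 := by
  simp [map_eval_fuchsPoly, eval_zero_gaugePoly]

theorem map_eval_neg_fuchsPoly (he : ∀ i, e i ≠ 0) (M : ι → Matrix n n K) (i : ι) :
    (fuchsPoly q e M).map (eval (-e i)) = residueFactor q e i • M i := by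
  have hfactor : -((1 - q) * -e i * (gaugeCofactor e i).eval (-e i)) = residueFactor q e i := by
    simp only [eval_gaugeCofactor, residueFactor, neg_div, ← sub_eq_add_neg]
    field_simp [he i]
  rw [map_eval_fuchsPoly, eval_neg_gaugePoly (he i), zero_smul, zero_sub,
    Finset.sum_eq_single i
      (fun j _ hj => by rw [eval_neg_gaugeCofactor_of_ne (he i) hj.symm, zero_smul])
      (fun h => absurd (Finset.mem_univ i) h), smul_smul, ← neg_smul, hfactor]

theorem natDegree_fuchsPoly_le (q : K) (e : ι → K) (M : ι → Matrix n n K) (a b : n) :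
    (fuchsPoly q e M a b).natDegree ≤ Fintype.card ι := by
  rw [fuchsPoly_apply, Finset.mul_sum]
  refine (natDegree_sub_le_of_le ((natDegree_mul_C_le _ _).trans (natDegree_gaugePoly_le e))
    (natDegree_sum_le_of_forall_le _ _ fun i _ => ?_)).trans_eq (max_self _)
  refine natDegree_mul_le.trans ((Nat.add_le_add ((natDegree_C_mul_le _ X).trans natDegree_X_le)
    (natDegree_mul_C_le _ _)).trans ?_)
  have := natDegree_gaugeCofactor_lt e i
  lia

theorem map_coeff_card_fuchsPoly [Nonempty ι] (q : K) (e : ι → K) (M : ι → Matrix n n K) :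
    (fuchsPoly q e M).map (coeff · (Fintype.card ι)) =
      (∏ i, e i)⁻¹ • (1 - (1 - q) • ∑ i, M i) := by
  obtain ⟨k, hk⟩ := Nat.exists_eq_add_one.2 (Fintype.card_pos (α := ι))
  have hP := coeff_card_gaugePoly e
  rw [hk] at hP ⊢
  ext a b
  simp only [Matrix.map_apply, fuchsPoly_apply, coeff_sub, coeff_mul_C, hP, mul_assoc, coeff_C_mul,
    coeff_X_mul, finsetSum_coeff, coeff_gaugeCofactor e _ hk, ← Finset.mul_sum, Matrix.smul_apply,
    Matrix.sub_apply, Matrix.sum_apply, smul_eq_mul]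
  ring

theorem eq_fuchsPoly_of_natDegree_le (hq : q ≠ 1) (hinj : Function.Injective e)
    (he : ∀ i, e i ≠ 0) {A : Matrix n n K[X]} (hdeg : ∀ a b, (A a b).natDegree ≤ Fintype.card ι)
    (h0 : A.map (eval 0) = 1) :
    A = fuchsPoly q e fun i => (residueFactor q e i)⁻¹ • A.map (eval (-e i)) := by
  let node : Option ι → K := fun o => o.elim 0 fun i => -e i
  have hnode : Function.Injective node :=
    Option.injective_iff.2 ⟨fun i j h => hinj (neg_injective h), fun ⟨i, hi⟩ =>
      he i (neg_eq_zero.1 hi)⟩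
  ext1 a b
  refine eq_of_natDegree_lt_card_of_eval_eq _ _ hnode (fun o => ?_) ?_
  · refine congrFun (congrFun (?_ : A.map (eval (node o)) = (fuchsPoly q e _).map _) a) b
    rcases o with _ | i
    · exact h0.trans (map_eval_zero_fuchsPoly q e _).symm
    · exact ((map_eval_neg_fuchsPoly he _ i).trans
        (smul_inv_smul₀ (residueFactor_ne_zero hq hinj he i) _)).symm
  · rw [Fintype.card_option, Nat.lt_succ_iff, max_le_iff]
    exact ⟨hdeg a b, natDegree_fuchsPoly_le q e _ a b⟩

theorem fuchsPoly_injective (hq : q ≠ 1) (hinj : Function.Injective e) (he : ∀ i, e i ≠ 0) :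
    Function.Injective (fuchsPoly (n := n) q e) := fun M N h => funext fun i =>
  smul_right_injective _ (residueFactor_ne_zero hq hinj he i) <| by
    simp only [← map_eval_neg_fuchsPoly he, h]

theorem fuchsPoly_comp (q : K) (e : ι → K) (M : ι → Matrix n n K) (τ : Equiv.Perm ι) :
    fuchsPoly q (e ∘ τ) (M ∘ τ) = fuchsPoly q e M := by
  have hP : gaugePoly (e ∘ τ) = gaugePoly e :=
    Equiv.prod_comp τ fun i => 1 + C (e i)⁻¹ * X
  have hcof (i : ι) : gaugeCofactor (e ∘ τ) i = gaugeCofactor e (τ i) := by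
    unfold gaugeCofactor
    congr 1
    exact Finset.prod_equiv τ (by simp) (by simp)
  unfold fuchsPoly
  rw [hP]
  congr 2
  simp only [hcof]
  exact Equiv.sum_comp τ fun i => gaugeCofactor e i • (M i).map C

theorem residueFactor_comp (q : K) (e : ι → K) (τ : Equiv.Perm ι) (i : ι) :
    residueFactor q (e ∘ τ) i = residueFactor q e (τ i) := by
  unfold residueFactor
  congr 1
  exact Finset.prod_equiv τ (by simp) (by simp)

theorem map_eval_fuchsPoly_mulVec_eq_zero_iff [Fintype n] (he : ∀ i, e i ≠ 0)
    (M : ι → Matrix n n K) {x : K} (hx : ∀ i, x + e i ≠ 0) (v : n → K) :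
    (fuchsPoly q e M).map (eval x) *ᵥ v = 0 ↔
      v = ((1 - q) * x) • ∑ i, (x + e i)⁻¹ • M i *ᵥ v := by
  rw [map_eval_fuchsPoly_of_add_ne_zero he M hx, Matrix.smul_mulVec,
    smul_eq_zero_iff_right (eval_gaugePoly_ne_zero he hx), Matrix.sub_mulVec, Matrix.one_mulVec,
    sub_eq_zero, Matrix.smul_mulVec, Matrix.sum_mulVec]
  simp only [Matrix.smul_mulVec]

theorem map_eval_fuchsPoly_conj [Fintype n] (G : GL n K) (M : ι → Matrix n n K) (x : K) :
    (fuchsPoly q e fun i => (↑G⁻¹ : Matrix n n K) * M i * (G : Matrix n n K)).map (eval x) =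
      (↑G⁻¹ : Matrix n n K) * (fuchsPoly q e M).map (eval x) * (G : Matrix n n K) := by
  simp only [map_eval_fuchsPoly, mul_sub, sub_mul, Matrix.mul_smul, Matrix.smul_mul,
    Matrix.mul_sum, Matrix.sum_mul, mul_one, Units.inv_mul]

end FuchsPoly

section DeterminantDegree

variable {K n : Type*} [Field K] [Fintype n] [DecidableEq n] {M : Matrix n n K[X]}

theorem natDegree_det_le {m : ℕ} (hM : ∀ i j, (M i j).natDegree ≤ m) :
    M.det.natDegree ≤ Fintype.card n * m := by
  rw [Matrix.det_apply]
  refine natDegree_sum_le_of_forall_le _ _ fun σ _ => (natDegree_smul_le _ _).trans ?_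
  exact (natDegree_prod_le _ _).trans (Finset.sum_le_card_nsmul _ _ m fun i _ => hM _ _)

theorem coeff_det_of_natDegree_le {m : ℕ} (hM : ∀ i j, (M i j).natDegree ≤ m) :
    M.det.coeff (Fintype.card n * m) = (M.map (coeff · m)).det := by
  simp only [Matrix.det_apply, finsetSum_coeff, coeff_smul, Matrix.map_apply]
  exact Finset.sum_congr rfl fun σ _ => congrArg _ <|
    coeff_prod_of_natDegree_le _ _ m fun i _ => hM _ _

theorem eq_C_mul_prod_X_add_C {ι : Type*} [Fintype ι] {e : ι → K} (hinj : Function.Injective e)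
    {p : K[X]} (hdeg : p.natDegree ≤ Fintype.card ι) (hroot : ∀ i, p.eval (-e i) = 0) :
    p = C (p.coeff (Fintype.card ι)) * ∏ i, (X + C (e i)) := by
  have hprod : (∏ i, (X + C (e i))).natDegree = Fintype.card ι := by
    rw [natDegree_prod_of_monic _ _ fun i _ => monic_X_add_C _]
    simp
  have hlead : (∏ i, (X + C (e i))).coeff (Fintype.card ι) = 1 := by
    rw [← hprod]
    exact monic_prod_of_monic _ _ fun i _ => monic_X_add_C _
  refine eq_of_degree_sub_lt_of_eval_index_eq Finset.univ (v := fun i => -e i)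
    (neg_injective.comp hinj).injOn ((degree_lt_iff_coeff_zero _ _).2 fun k hk => ?_) fun i _ => ?_
  · rw [Finset.card_univ] at hk
    rw [coeff_sub, coeff_C_mul]
    rcases hk.eq_or_lt with rfl | hlt
    · rw [hlead, mul_one, sub_self]
    · rw [coeff_eq_zero_of_natDegree_lt (hdeg.trans_lt hlt),
        coeff_eq_zero_of_natDegree_lt (hprod.trans_lt hlt), mul_zero, sub_zero]
  · rw [hroot, eval_mul, eval_prod, Finset.prod_eq_zero (Finset.mem_univ i) (by simp), mul_zero]

end DeterminantDegree

section SimpleRoots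

variable {K n : Type*} [Field K] [Fintype n] [DecidableEq n]

theorem finrank_ker_toLin'_le_one_of_adjugate_ne_zero {M : Matrix n n K} (hM : M.adjugate ≠ 0) :
    finrank K (LinearMap.ker M.toLin') ≤ 1 := by
  obtain ⟨i, j, hij⟩ : ∃ i j, M.adjugate i j ≠ 0 := by
    by_contra! h
    exact hM (Matrix.ext h)
  rw [Matrix.adjugate_apply] at hij
  refine (LinearMap.finrank_le_finrank_of_injective
    (f := LinearMap.proj i ∘ₗ (LinearMap.ker M.toLin').subtype) ?_).trans_eq (finrank_self K)
  refine (injective_iff_map_eq_zero _).2 fun ⟨v, hv⟩ hvi => Subtype.ext ?_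
  replace hv : M.mulVec v = 0 := hv
  replace hvi : v i = 0 := hvi
  refine Matrix.eq_zero_of_mulVec_eq_zero hij (funext fun k => ?_)
  rw [Matrix.updateRow_mulVec, hv]
  rcases eq_or_ne k j with rfl | hk <;> simp [*]

/-- If the adjugate of `M` vanished at `a`, then `(X - a) ^ n` would divide the determinant
`(det M) ^ (n - 1)` of the adjugate. -/
theorem adjugate_map_eval_ne_zero [Nonempty n] {M : Matrix n n K[X]} (hM : M.det.Separable)
    (a : K) : (M.map (eval a)).adjugate ≠ 0 := by
  classical
  intro hzero
  have hroot (i j : n) : X - C a ∣ M.adjugate i j := by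
    rw [dvd_iff_isRoot]
    exact congrFun (congrFun ((RingHom.map_adjugate (evalRingHom a) M).trans hzero) i) j
  choose N hN using hroot
  have hdvd : (X - C a) ^ Fintype.card n ∣ M.det ^ (Fintype.card n - 1) := by
    rw [← Matrix.det_adjugate, show M.adjugate = (X - C a) • Matrix.of N from Matrix.ext hN,
      Matrix.det_smul]
    exact dvd_mul_right _ _
  have hle := (le_rootMultiplicity_iff (pow_ne_zero _ hM.ne_zero)).2 hdvd
  rw [← count_roots, roots_pow, Multiset.count_nsmul, count_roots] at hle
  have hpos := Fintype.card_pos (α := n)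
  have hsimple := Nat.mul_le_mul_left (Fintype.card n - 1)
    (rootMultiplicity_le_one_of_separable hM a)
  lia

theorem finrank_ker_map_eval_le_one {M : Matrix n n K[X]} (hM : M.det.Separable)
    (a : K) : finrank K (LinearMap.ker (M.map (eval a)).toLin') ≤ 1 := by
  cases isEmpty_or_nonempty n
  · exact (Submodule.finrank_le _).trans (by simp)
  · exact finrank_ker_toLin'_le_one_of_adjugate_ne_zero (adjugate_map_eval_ne_zero hM a)

end SimpleRoots

section MiddleConvolutionMap

variable {K ι V W : Type*} [Field K] [Fintype ι] [AddCommGroup V] [Module K V]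
  [AddCommGroup W] [Module K W] {c s : K} {B : ι → Module.End K V} {C : ι → Module.End K W}

/-- The nonzero block row `(c B_1, …, c B_i + s I, …, c B_N)` of the `i`-th convolution matrix,
with `c = q ^ λ` and `s = [λ]`. -/
def convRow (c s : K) (B : ι → Module.End K V) (i : ι) : (ι → V) →ₗ[K] V :=
  (∑ j, c • (B j ∘ₗ LinearMap.proj j)) + s • LinearMap.proj i

/-- The endomorphism of `V ^ N` with the block rows `B_i (c B_1, …, c B_i + s I, …, c B_N)`. In the
situation of the theorem its kernel is `𝒦 + ℒ`, so that its image is a model of the middle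
convolution. -/
def mcMap (c s : K) (B : ι → Module.End K V) : (ι → V) →ₗ[K] (ι → V) :=
  LinearMap.pi fun i => B i ∘ₗ convRow c s B i

theorem convRow_apply (c s : K) (B : ι → Module.End K V) (i : ι) (v : ι → V) :
    convRow c s B i v = c • ∑ j, B j (v j) + s • v i := by
  simp [convRow, Finset.smul_sum]

theorem mcMap_apply (c s : K) (B : ι → Module.End K V) (v : ι → V) (i : ι) :
    mcMap c s B v i = B i (convRow c s B i v) := rfl

theorem sum_apply_of_smul_sum_eq (hB : c • ∑ i, B i = -s • 1) (u : V) :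
    c • ∑ i, B i u = -(s • u) := by
  simpa using LinearMap.congr_fun hB u

theorem eq_zero_of_forall_apply_eq_zero (hs : s ≠ 0) (hB : c • ∑ i, B i = -s • 1) {u : V}
    (hu : ∀ i, B i u = 0) : u = 0 := by
  have h := sum_apply_of_smul_sum_eq hB u
  simp only [hu, Finset.sum_const_zero, smul_zero, zero_eq_neg] at h
  exact (smul_eq_zero.1 h).resolve_left hs

theorem mem_ker_mcMap_iff (hs : s ≠ 0) (hB : c • ∑ i, B i = -s • 1) {v : ι → V} :
    v ∈ LinearMap.ker (mcMap c s B) ↔ ∃ u, ∀ i, B i (v i) = B i u := by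
  simp only [LinearMap.mem_ker, funext_iff, Pi.zero_apply, mcMap_apply, convRow_apply, map_add,
    map_smul (B _) s]
  refine ⟨fun h => ⟨-(s⁻¹ • c • ∑ j, B j (v j)), fun i => ?_⟩, fun ⟨u, hu⟩ i => ?_⟩
  · rw [map_neg, map_smul, eq_neg_of_add_eq_zero_left (h i), smul_neg, neg_neg,
      inv_smul_smul₀ hs]
  · simp only [hu, sum_apply_of_smul_sum_eq hB u, map_neg, map_smul, neg_add_cancel]

theorem finrank_ker_mcMap [FiniteDimensional K V] (hs : s ≠ 0) (hB : c • ∑ i, B i = -s • 1) :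
    finrank K (LinearMap.ker (mcMap c s B)) =
      ∑ i, finrank K (LinearMap.ker (B i)) + finrank K V := by
  let f : ((∀ i, LinearMap.ker (B i)) × V) →ₗ[K] (ι → V) :=
    LinearMap.pi fun i =>
      ((LinearMap.ker (B i)).subtype ∘ₗ LinearMap.proj i).coprod LinearMap.id
  have hf (k : ∀ i, LinearMap.ker (B i)) (u : V) (i : ι) : f (k, u) i = k i + u := rfl
  have hinj : Function.Injective f := (injective_iff_map_eq_zero f).2 fun ⟨k, u⟩ h => by
    have hk (i : ι) : (k i : V) = -u := eq_neg_of_add_eq_zero_left (congrFun h i)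
    have hu : u = 0 := eq_zero_of_forall_apply_eq_zero hs hB fun i => by
      rw [← neg_eq_zero, ← map_neg, ← hk i]
      exact (k i).2
    subst hu
    exact Prod.ext (funext fun i => Subtype.ext ((hk i).trans neg_zero)) rfl
  have hrange : LinearMap.range f = LinearMap.ker (mcMap c s B) := by
    ext v
    rw [mem_ker_mcMap_iff hs hB]
    constructor
    · rintro ⟨⟨k, u⟩, rfl⟩
      exact ⟨u, fun i => by rw [hf, map_add, (k i).2, zero_add]⟩
    · rintro ⟨u, hu⟩
      exact ⟨(fun i => ⟨v i - u, by rw [LinearMap.mem_ker, map_sub, hu i, sub_self]⟩, u),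
        funext fun i => sub_add_cancel (v i) u⟩
  rw [← hrange, LinearMap.finrank_range_of_inj hinj, finrank_prod, finrank_pi_fintype]

variable [DecidableEq ι]

theorem convRow_single (c s : K) (B : ι → Module.End K V) (i j : ι) (y : V) :
    convRow c s B i (Pi.single j y) = c • B j y + if i = j then s • y else 0 := by
  have hsum : ∑ k, B k (Pi.single (M := fun _ => V) j y k) = B j y := by
    rw [Finset.sum_eq_single j (fun k _ hk => by rw [Pi.single_eq_of_ne hk, map_zero])
      (fun h => absurd (Finset.mem_univ j) h), Pi.single_eq_same]
  rw [convRow_apply, hsum, Pi.single_apply, smul_ite, smul_zero]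

theorem mcMap_single (c s : K) (B : ι → Module.End K V) (i j : ι) (y : V) :
    mcMap c s B (Pi.single j y) i = c • B i (B j y) + if i = j then s • B j y else 0 := by
  rw [mcMap_apply, convRow_single, map_add, map_smul]
  split_ifs with h
  · rw [map_smul, h]
  · rw [map_zero]

theorem mcMap_single_eq_zero {i : ι} {y : V} (hy : B i y = 0) :
    mcMap c s B (Pi.single i y) = 0 :=
  funext fun k => by rw [mcMap_single, hy, map_zero, smul_zero, smul_zero, ite_self, zero_add,
    Pi.zero_apply]

theorem single_convRow_mem_ker_mcMap {v : ι → V} (hv : v ∈ LinearMap.ker (mcMap c s B)) (i : ι) :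
    Pi.single i (convRow c s B i v) ∈ LinearMap.ker (mcMap c s B) :=
  mcMap_single_eq_zero (congrFun hv i)

/-- `C` is, in some basis, the tuple of endomorphisms that the convolution of `B` induces on
`V ^ N / Ker (mcMap c s B)`; the map `π` is the projection to this quotient. -/
def IsMC (c s : K) (B : ι → Module.End K V) (C : ι → Module.End K W) : Prop :=
  ∃ π : (ι → V) →ₗ[K] W, Function.Surjective π ∧
    LinearMap.ker π = LinearMap.ker (mcMap c s B) ∧
    ∀ i v, π (Pi.single i (convRow c s B i v)) = C i (π v)

theorem IsMC.conj {V' : Type*} [AddCommGroup V'] [Module K V'] (h : IsMC c s B C)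
    (E : V ≃ₗ[K] V') : IsMC c s (fun i => E.conj (B i)) C := by
  obtain ⟨π, hsurj, hker, hC⟩ := h
  have hrow (i : ι) (v : ι → V') : E.symm (convRow c s (fun i => E.conj (B i)) i v) =
      convRow c s B i fun i => E.symm (v i) := by
    simp [convRow_apply, LinearEquiv.conj_apply]
  let E' : (ι → V') ≃ₗ[K] (ι → V) := LinearEquiv.piCongrRight fun _ => E.symm
  have hE' (v : ι → V') : E' v = fun i => E.symm (v i) := rfl
  refine ⟨π ∘ₗ E', hsurj.comp E'.surjective, ?_, fun i v => ?_⟩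
  · ext v
    have hv := SetLike.ext_iff.1 hker (E' v)
    simp only [LinearMap.mem_ker, funext_iff, mcMap_apply, Pi.zero_apply] at hv ⊢
    refine hv.trans (forall_congr' fun i => ?_)
    rw [hE', ← hrow]
    simp [LinearEquiv.conj_apply]
  · have hsingle : E' (Pi.single i (convRow c s (fun i => E.conj (B i)) i v)) =
        Pi.single i (convRow c s B i (E' v)) := by
      rw [hE' v, ← hrow]
      exact funext fun k => (Pi.apply_single (fun _ => E.symm) (fun _ => map_zero _) i _ k)
    exact (congrArg π hsingle).trans (hC i _)

theorem IsMC.comp_perm (h : IsMC c s B C) (τ : Equiv.Perm ι) :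
    IsMC c s (B ∘ τ) (C ∘ τ) := by
  obtain ⟨π, hsurj, hker, hC⟩ := h
  have hrow (i : ι) (v : ι → V) :
      convRow c s (B ∘ τ) i v = convRow c s B (τ i) (v ∘ τ.symm) := by
    simp only [convRow_apply, Function.comp_apply, Equiv.symm_apply_apply]
    rw [← Equiv.sum_comp τ fun j => B j (v (τ.symm j))]
    simp only [Equiv.symm_apply_apply]
  let E : (ι → V) ≃ₗ[K] (ι → V) := LinearEquiv.funCongrLeft K V τ.symm
  have hE (v : ι → V) : E v = v ∘ τ.symm := rfl
  refine ⟨π ∘ₗ E, hsurj.comp E.surjective, ?_, fun i v => ?_⟩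
  · ext v
    have hv := SetLike.ext_iff.1 hker (E v)
    simp only [LinearMap.mem_ker, funext_iff, mcMap_apply, Pi.zero_apply] at hv ⊢
    refine hv.trans (τ.forall_congr_right.symm.trans (forall_congr' fun i => ?_))
    rw [hE, ← hrow]
    rfl
  · have hsingle : E (Pi.single i (convRow c s (B ∘ τ) i v)) =
        Pi.single (τ i) (convRow c s B (τ i) (E v)) := by
      rw [hE, hE, hrow, Pi.single_comp_equiv, Equiv.symm_symm]
    exact (congrArg π hsingle).trans (hC (τ i) _)

theorem IsMC.exists_conj {W' : Type*} [AddCommGroup W'] [Module K W'] {C' : ι → Module.End K W'}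
    (h : IsMC c s B C) (h' : IsMC c s B C') : ∃ F : W ≃ₗ[K] W', ∀ i, C' i = F.conj (C i) := by
  obtain ⟨π, hsurj, hker, hC⟩ := h
  obtain ⟨π', hsurj', hker', hC'⟩ := h'
  let F : W ≃ₗ[K] W' := (π.quotKerEquivOfSurjective hsurj).symm ≪≫ₗ
    Submodule.quotEquivOfEq _ _ (hker.trans hker'.symm) ≪≫ₗ π'.quotKerEquivOfSurjective hsurj'
  have hF (v : ι → V) : F (π v) = π' v := by
    have h1 : (π.quotKerEquivOfSurjective hsurj).symm (π v) = Submodule.Quotient.mk v :=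
      (LinearEquiv.symm_apply_eq _).2 rfl
    simp only [F, LinearEquiv.trans_apply, h1]
    rfl
  refine ⟨F, fun i => LinearMap.ext fun w => ?_⟩
  obtain ⟨v, rfl⟩ := hsurj' w
  rw [LinearEquiv.conj_apply_apply, ← hF v, LinearEquiv.symm_apply_apply, ← hC, hF, hF, hC']

theorem IsMC.sum_eq (h : IsMC c s B C) (hs : s ≠ 0) (hB : c • ∑ i, B i = -s • 1) :
    ∑ i, C i = s • 1 := by
  obtain ⟨π, hsurj, hker, hC⟩ := h
  refine LinearMap.ext fun w => ?_
  obtain ⟨v, rfl⟩ := hsurj w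
  have hconst : π (fun _ => c • ∑ j, B j (v j)) = 0 := by
    rw [← LinearMap.mem_ker, hker, mem_ker_mcMap_iff hs hB]
    exact ⟨_, fun _ => rfl⟩
  calc (∑ i, C i) (π v) = π (∑ i, Pi.single i (convRow c s B i v)) := by
        simp only [LinearMap.sum_apply, map_sum, hC]
    _ = π ((fun _ => c • ∑ j, B j (v j)) + s • v) := by
        rw [Finset.univ_sum_single fun i => convRow c s B i v]
        exact congrArg π (funext fun i => convRow_apply c s B i v)
    _ = s • π v := by rw [map_add, hconst, zero_add, map_smul]

theorem IsMC.not_injective [FiniteDimensional K V] [FiniteDimensional K W] (h : IsMC c s B C)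
    (hVW : finrank K V = finrank K W) {i : ι} (hi : LinearMap.ker (B i) ≠ ⊥) :
    ¬ Function.Injective (C i) := by
  obtain ⟨π, hsurj, hker, hC⟩ := h
  intro hinj
  have hblock : Function.Surjective (π ∘ₗ LinearMap.single K (fun _ => V) i) := fun w => by
    obtain ⟨w', rfl⟩ := LinearMap.surjective_of_injective hinj w
    obtain ⟨v, rfl⟩ := hsurj w'
    exact ⟨convRow c s B i v, hC i v⟩
  refine hi ((Submodule.eq_bot_iff _).2 fun y hy => ?_)
  refine (LinearMap.injective_iff_surjective_of_finrank_eq_finrank hVW).2 hblock ?_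
  rw [map_zero]
  exact (SetLike.ext_iff.1 hker _).2 (mcMap_single_eq_zero hy)

/-- The middle convolution carries a solution `v` of the eigenvector equation at `c x` to the
solution `((c x + e_i)⁻¹ v)_i` of the equation at `x`. -/
theorem IsMC.exists_eq_smul_sum (h : IsMC c s B C) {q x : K} {e : ι → K}
    (hcs : (1 - q) * s = 1 - c) (hxe : ∀ i, x + e i ≠ 0)
    (hcxe : ∀ i, c * x + e i ≠ 0) {v : V} (hv : v ≠ 0)
    (hfix : v = ((1 - q) * (c * x)) • ∑ i, (c * x + e i)⁻¹ • B i v) :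
    ∃ w ≠ 0, w = ((1 - q) * x) • ∑ i, (x + e i)⁻¹ • C i w := by
  obtain ⟨π, -, hker, hC⟩ := h
  set z : ι → V := fun i => (c * x + e i)⁻¹ • v with hz
  have hrow (i : ι) : ((1 - q) * x) • (x + e i)⁻¹ • convRow c s B i z = z i := by
    have hcsum : ((1 - q) * x) • c • ∑ j, B j (z j) = v := by
      simp only [hz, map_smul]
      rw [smul_smul, mul_assoc, mul_comm x c]
      exact hfix.symm
    have hscalar : (1 + (1 - c) * x * (c * x + e i)⁻¹) = (x + e i) * (c * x + e i)⁻¹ := by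
      field_simp [hcxe i]
      ring
    calc ((1 - q) * x) • (x + e i)⁻¹ • convRow c s B i z
        = (x + e i)⁻¹ • (((1 - q) * x) • c • ∑ j, B j (z j) + ((1 - q) * s * x) • z i) := by
          rw [convRow_apply, smul_comm, smul_add, smul_smul _ s, mul_right_comm]
      _ = (x + e i)⁻¹ • (1 + (1 - c) * x * (c * x + e i)⁻¹) • v := by
          rw [hcsum, hcs, hz, smul_smul, add_smul, one_smul]
      _ = z i := by rw [hscalar, mul_smul, inv_smul_smul₀ (hxe i)]
  refine ⟨π z, fun h0 => hv ?_, ?_⟩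
  · have hBv (i : ι) : B i v = 0 := by
      have h0' : B i (convRow c s B i z) = 0 :=
        congrFun ((SetLike.ext_iff.1 hker z).1 h0) i
      have h1 := congrArg (B i) (hrow i)
      rw [map_smul, map_smul, h0', smul_zero, smul_zero, map_smul, eq_comm] at h1
      exact (smul_eq_zero.1 h1).resolve_left (inv_ne_zero (hcxe i))
    rw [hfix]
    simp only [hBv, smul_zero, Finset.sum_const_zero]
  · have hblock (i : ι) : π (Pi.single i (z i)) = ((1 - q) * x) • (x + e i)⁻¹ • C i (π z) := by
      rw [← hC, ← map_smul, ← map_smul, ← Pi.single_smul, ← Pi.single_smul, hrow]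
    rw [Finset.smul_sum, ← Finset.sum_congr rfl fun i _ => hblock i, ← map_sum,
      Finset.univ_sum_single]

end MiddleConvolutionMap

section Chart

variable {K ι V W : Type*} [Field K] [Fintype ι] [DecidableEq ι] [AddCommGroup V] [Module K V]
  [AddCommGroup W] [Module K W] {c s : K} {B : ι → Module.End K V}

theorem exists_comp_comp_eq_id {U U' : Type*} [AddCommGroup U] [Module K U] [AddCommGroup U']
    [Module K U'] [FiniteDimensional K U'] [FiniteDimensional K W] {f : U →ₗ[K] U'}
    (hf : finrank K (LinearMap.range f) = finrank K W) :
    ∃ (ρ : U' →ₗ[K] W) (σ : W →ₗ[K] U), ρ ∘ₗ f ∘ₗ σ = LinearMap.id := by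
  let E : LinearMap.range f ≃ₗ[K] W := LinearEquiv.ofFinrankEq _ _ hf
  obtain ⟨p, hp⟩ := (LinearMap.range f).subtype.exists_leftInverse_of_injective
    (Submodule.ker_subtype _)
  obtain ⟨r, hr⟩ := f.rangeRestrict.exists_rightInverse_of_surjective f.range_rangeRestrict
  refine ⟨E.toLinearMap ∘ₗ p, r ∘ₗ E.symm.toLinearMap, LinearMap.ext fun w => ?_⟩
  have hfr : f (r (E.symm w)) = E.symm w := congrArg Subtype.val (LinearMap.congr_fun hr _)
  have hpE : p (E.symm w) = E.symm w := LinearMap.congr_fun hp (E.symm w)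
  simp only [LinearMap.comp_apply, LinearEquiv.coe_coe, hfr, hpE, LinearEquiv.apply_symm_apply,
    LinearMap.id_apply]

/-- The middle convolution of `B` in the chart of the image of `mcMap c s B` that `ρ` defines, for
a right inverse `N` of `ρ ∘ mcMap c s B ∘ σ`. -/
def mcChart (c s : K) (B : ι → Module.End K V) (ρ : (ι → V) →ₗ[K] W) (σ : W →ₗ[K] ι → V)
    (N : Module.End K W) (i : ι) : Module.End K W :=
  ρ ∘ₗ mcMap c s B ∘ₗ LinearMap.single K (fun _ => V) i ∘ₗ convRow c s B i ∘ₗ σ ∘ₗ N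

theorem isMC_mcChart [FiniteDimensional K V]
    (hrank : finrank K (LinearMap.range (mcMap c s B)) = finrank K W)
    {ρ : (ι → V) →ₗ[K] W} {σ : W →ₗ[K] ι → V} {N : Module.End K W}
    (hN : (ρ ∘ₗ mcMap c s B ∘ₗ σ) ∘ₗ N = LinearMap.id) :
    IsMC c s B (mcChart c s B ρ σ N) := by
  set f := mcMap c s B
  have hright (w : W) : ρ (f (σ (N w))) = w := LinearMap.congr_fun hN w
  have hsurj : Function.Surjective (ρ ∘ₗ f) := fun w => ⟨σ (N w), hright w⟩
  have hker : LinearMap.ker (ρ ∘ₗ f) = LinearMap.ker f := by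
    refine (Submodule.eq_of_le_of_finrank_eq (LinearMap.ker_le_ker_comp f ρ) ?_).symm
    have h1 := (ρ ∘ₗ f).finrank_range_add_finrank_ker
    have h2 := f.finrank_range_add_finrank_ker
    rw [LinearMap.range_eq_top.2 hsurj, finrank_top] at h1
    lia
  refine ⟨ρ ∘ₗ f, hsurj, hker, fun i v => ?_⟩
  have hdiff : v - σ (N (ρ (f v))) ∈ LinearMap.ker f := by
    rw [← hker, LinearMap.mem_ker, map_sub, LinearMap.comp_apply, LinearMap.comp_apply, hright,
      sub_self]
  have hstable := single_convRow_mem_ker_mcMap hdiff i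
  rw [map_sub, Pi.single_sub, LinearMap.sub_mem_ker_iff] at hstable
  exact congrArg ρ hstable

theorem exists_isMC [FiniteDimensional K V] [FiniteDimensional K W]
    (hrank : finrank K (LinearMap.range (mcMap c s B)) = finrank K W) :
    ∃ C : ι → Module.End K W, IsMC c s B C := by
  obtain ⟨ρ, σ, h⟩ := exists_comp_comp_eq_id hrank
  exact ⟨_, isMC_mcChart (N := LinearMap.id) hrank h⟩

end Chart

section Comparison

variable {ι V W : Type*} [Fintype ι] [DecidableEq ι] [AddCommGroup V] [Module ℂ V]
  [AddCommGroup W] [Module ℂ W] {q lam : ℂ} {B : ι → Module.End ℂ V} {C : ι → Module.End ℂ W}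

theorem qConv_eq_single_convRow (q lam : ℂ) (B : ι → Module.End ℂ V) (i : ι) (v : ι → V) :
    qConv q lam B i v = Pi.single i (convRow (q ^ lam) (qNumber q lam) B i v) := rfl

theorem mem_mcL_iff {v : ι → V} :
    v ∈ mcL q lam B ↔ ∀ i, convRow (q ^ lam) (qNumber q lam) B i v = 0 := by
  simp only [mcL, LinearMap.mem_ker, LinearMap.sum_apply, qConv_eq_single_convRow, funext_iff,
    Finset.univ_sum_single, Pi.zero_apply]

theorem mcK_sup_mcL_eq_ker_mcMap (hs : qNumber q lam ≠ 0)
    (hB : q ^ lam • ∑ i, B i = -qNumber q lam • 1) :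
    mcK B ⊔ mcL q lam B = LinearMap.ker (mcMap (q ^ lam) (qNumber q lam) B) := by
  refine le_antisymm (sup_le (fun v hv => ?_) fun v hv => ?_) fun v hv => ?_
  · exact (mem_ker_mcMap_iff hs hB).2 ⟨0, fun i => by
      rw [map_zero, Submodule.mem_pi.1 hv i (Set.mem_univ i)]⟩
  · exact funext fun i => by rw [mcMap_apply, mem_mcL_iff.1 hv i, map_zero, Pi.zero_apply]
  · obtain ⟨u, hu⟩ := (mem_ker_mcMap_iff hs hB).1 hv
    have hconst : (fun _ => u) ∈ mcL q lam B := mem_mcL_iff.2 fun i => by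
      rw [convRow_apply, sum_apply_of_smul_sum_eq hB, neg_add_cancel]
    have hdiff : v - (fun _ => u) ∈ mcK B := Submodule.mem_pi.2 fun i _ => by
      rw [LinearMap.mem_ker, Pi.sub_apply, map_sub, hu, sub_self]
    exact sub_add_cancel v (fun _ => u) ▸ Submodule.add_mem_sup hdiff hconst

theorem isMC_iff_exists_eq_conj_qMC (hs : qNumber q lam ≠ 0)
    (hB : q ^ lam • ∑ i, B i = -qNumber q lam • 1) :
    IsMC (q ^ lam) (qNumber q lam) B C ↔
      ∃ ψ : MCSpace q lam B ≃ₗ[ℂ] W, ∀ i, C i = ψ.conj (qMC q lam B i) := by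
  have hsup := mcK_sup_mcL_eq_ker_mcMap hs hB
  constructor
  · rintro ⟨π, hsurj, hker, hC⟩
    let ψ : MCSpace q lam B ≃ₗ[ℂ] W :=
      Submodule.quotEquivOfEq _ _ (hsup.trans hker.symm) ≪≫ₗ π.quotKerEquivOfSurjective hsurj
    have hψ (v : ι → V) : ψ (Submodule.Quotient.mk v) = π v := rfl
    refine ⟨ψ, fun i => LinearMap.ext fun w => ?_⟩
    obtain ⟨v, rfl⟩ := hsurj w
    rw [← hC, LinearEquiv.conj_apply_apply, ← hψ v, LinearEquiv.symm_apply_apply]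
    rfl
  · rintro ⟨ψ, hψ⟩
    refine ⟨ψ.toLinearMap ∘ₗ Submodule.mkQ _, ψ.surjective.comp (Submodule.mkQ_surjective _),
      ?_, fun i v => ?_⟩
    · rw [LinearEquiv.ker_comp, Submodule.ker_mkQ, hsup]
    · rw [hψ, LinearEquiv.conj_apply_apply, LinearMap.comp_apply, LinearMap.comp_apply,
        LinearEquiv.coe_coe, LinearEquiv.symm_apply_apply]
      rfl

end Comparison

section Involution

variable {ι V W : Type*} [Fintype ι] [AddCommGroup V] [Module ℂ V] [AddCommGroup W] [Module ℂ W]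
  {c s c' s' : ℂ} {B : ι → Module.End ℂ V} {C : ι → Module.End ℂ W}

theorem StarStar.convRow_surjective (hstarstar : StarStar B) (hc : c ≠ 0) (i : ι) :
    Function.Surjective (convRow c s B i) := by
  classical
  rw [← LinearMap.range_eq_top, eq_top_iff, ← hstarstar i (c⁻¹ * s)]
  have hsingle (j : ι) (y : V) : convRow c s B i (Pi.single j (c⁻¹ • y)) =
      B j y + if i = j then (c⁻¹ * s) • y else 0 := by
    rw [convRow_single, map_smul, smul_inv_smul₀ hc, smul_smul, mul_comm]
  refine sup_le (iSup₂_le fun j (hj : j ≠ i) => ?_) ?_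
  · rintro _ ⟨y, rfl⟩
    exact ⟨_, (hsingle j y).trans (by rw [if_neg hj.symm, add_zero])⟩
  · rintro _ ⟨y, rfl⟩
    exact ⟨_, (hsingle i y).trans (by rw [if_pos rfl]; rfl)⟩

variable [DecidableEq ι]

theorem Star.apply_eq_zero_of_mcMap_single_eq_zero (hstar : Star B) (hc : c ≠ 0) {i : ι} {y : V}
    (hy : mcMap c s B (Pi.single i y) = 0) : B i y = 0 := by
  have hmem : B i y ∈ (⨅ k ∈ {k : ι | k ≠ i}, LinearMap.ker (B k)) ⊓
      LinearMap.ker (B i + (c⁻¹ * s) • (1 : Module.End ℂ V)) := by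
    simp only [Submodule.mem_inf, Submodule.mem_iInf, LinearMap.mem_ker]
    refine ⟨fun k (hk : k ≠ i) => ?_, ?_⟩
    · have h := congrFun hy k
      rw [mcMap_single, if_neg hk, add_zero, Pi.zero_apply] at h
      exact (smul_eq_zero.1 h).resolve_left hc
    · have h := congrFun hy i
      rw [mcMap_single, if_pos rfl, Pi.zero_apply] at h
      have hunit := congrArg (c⁻¹ • ·) h
      rw [smul_add, inv_smul_smul₀ hc, smul_smul, smul_zero] at hunit
      exact hunit
  rwa [hstar, Submodule.mem_bot] at hmem

/-- The inverse projection sums the diagonal blocks `B_i (c B_1, …, c B_i + s I, …, c B_N)` of the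
embedding `Ψ` of `W` into `V ^ N` that `mcMap c s B` induces. -/
theorem IsMC.symm (h : IsMC c s B C) (hs : s ≠ 0) (hB : c • ∑ i, B i = -s • 1) (hstar : Star B)
    (hstarstar : StarStar B) (hc : c' * c = 1) (hs' : s' = -(c' * s)) : IsMC c' s' C B := by
  have hc0 : c ≠ 0 := right_ne_zero_of_mul_eq_one hc
  obtain ⟨π, hsurj, hker, hC⟩ := h
  obtain ⟨Ψ, hΨ⟩ : ∃ Ψ : W →ₗ[ℂ] (ι → V), ∀ v, Ψ (π v) = mcMap c s B v := by
    obtain ⟨r, hr⟩ := π.exists_rightInverse_of_surjective (LinearMap.range_eq_top.2 hsurj)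
    refine ⟨mcMap c s B ∘ₗ r, fun v => ?_⟩
    have hmem : r (π v) - v ∈ LinearMap.ker (mcMap c s B) := by
      rw [← hker, LinearMap.mem_ker, map_sub, sub_eq_zero]
      exact LinearMap.congr_fun hr (π v)
    exact LinearMap.sub_mem_ker_iff.1 hmem
  have hΨC (j : ι) (w : W) (i : ι) :
      Ψ (C j w) i = c • B i (Ψ w j) + if i = j then s • Ψ w j else 0 := by
    obtain ⟨v, rfl⟩ := hsurj w
    rw [← hC, hΨ, mcMap_single, hΨ, mcMap_apply]
  have hCzero (i : ι) (w : W) : C i w = 0 ↔ Ψ w i = 0 := by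
    obtain ⟨v, rfl⟩ := hsurj w
    rw [← hC, ← LinearMap.mem_ker, hker, LinearMap.mem_ker, hΨ, mcMap_apply]
    exact ⟨hstar.apply_eq_zero_of_mcMap_single_eq_zero hc0, mcMap_single_eq_zero⟩
  let Φ : (ι → W) →ₗ[ℂ] V := ∑ i, LinearMap.proj i ∘ₗ Ψ ∘ₗ LinearMap.proj i
  have hΦ (w : ι → W) : Φ w = ∑ i, Ψ (w i) i := by simp [Φ]
  have hΦrow (i : ι) (w : ι → W) : Ψ (convRow c' s' C i w) i = B i (Φ w) := by
    simp only [convRow_apply, map_add, map_smul, map_sum, Pi.add_apply, Pi.smul_apply,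
      Finset.sum_apply, hΨC, hΦ, Finset.sum_add_distrib, Finset.sum_ite_eq, Finset.mem_univ,
      if_true, smul_add, ← Finset.smul_sum, smul_smul, hc, one_smul]
    rw [hs', neg_smul, add_neg_cancel_right]
  have hΦsingle (i : ι) (y : W) : Φ (Pi.single i y) = Ψ y i := by
    rw [hΦ, Finset.sum_eq_single i
      (fun j _ hj => by rw [Pi.single_eq_of_ne hj, map_zero, Pi.zero_apply])
      (fun h => absurd (Finset.mem_univ i) h), Pi.single_eq_same]
  refine ⟨Φ, fun u => ?_, ?_, fun i w => (hΦsingle i _).trans (hΦrow i w)⟩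
  · choose v hv using fun i => hstarstar.convRow_surjective (s := s) hc0 i (-(s⁻¹ • c • u))
    refine ⟨fun i => π (v i), ?_⟩
    simp only [hΦ, hΨ, mcMap_apply, hv, map_neg, map_smul, Finset.sum_neg_distrib,
      ← Finset.smul_sum, sum_apply_of_smul_sum_eq hB]
    rw [smul_neg, neg_neg, inv_smul_smul₀ hs]
  · ext w
    simp only [LinearMap.mem_ker, funext_iff, mcMap_apply, hCzero, hΦrow, Pi.zero_apply]
    exact ⟨fun h => by simp [h], eq_zero_of_forall_apply_eq_zero hs hB⟩

end Involution

namespace QSystem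

variable {q : ℂ} {d : QSystem}

theorem isE8_iff : d.IsE8 ↔ (∀ i j, (d.A i j).natDegree ≤ 3) ∧ d.at' 0 = 1 ∧
    d.A.map (coeff · 3) = d.κ • (1 : Matrix (Fin 3) (Fin 3) ℂ) ∧
    d.A.det = C (d.κ ^ 3) * ∏ i, (X + C (d.e i)) ∧ Function.Injective d.e := by
  constructor
  · rintro ⟨⟨A₁, A₂, hA⟩, hdet, hinj⟩
    have hpoly (i j : Fin 3) : d.A i j = C ((1 : Matrix (Fin 3) (Fin 3) ℂ) i j) +
        C (A₁ i j) * X + C (A₂ i j) * X ^ 2 + C ((d.κ • (1 : Matrix _ _ ℂ)) i j) * X ^ 3 := by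
      refine Polynomial.funext fun x => ?_
      have h := congrFun (congrFun (hA x) i) j
      simp only [at', Matrix.map_apply, Matrix.add_apply, Matrix.smul_apply, smul_eq_mul] at h
      simp only [h, eval_add, eval_mul, eval_C, eval_X, eval_pow, Matrix.smul_apply, smul_eq_mul]
      ring
    refine ⟨fun i j => ?_, by simp [hA], ?_, ?_, hinj⟩
    · rw [hpoly]
      compute_degree
    · ext i j
      simp only [Matrix.map_apply, hpoly, coeff_add, coeff_C_mul, coeff_X_pow,
        coeff_X_of_ne_one (n := 3) (by decide)]
      simp
    · refine Polynomial.funext fun x => ?_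
      rw [eval_det_eq_det_map_eval]
      exact (hdet x).trans (by simp [eval_prod])
  · rintro ⟨hdeg, h0, h3, hdet, hinj⟩
    refine ⟨⟨d.A.map (coeff · 1), d.A.map (coeff · 2), fun x => ?_⟩, fun x => ?_, hinj⟩
    · rw [mul_comm, mul_smul, ← h3, ← h0]
      ext i j
      rw [at', Matrix.map_apply, eval_eq_sum_range' (Nat.lt_succ_of_le (hdeg i j))]
      simp [Finset.sum_range_succ, at', ← coeff_zero_eq_eval_zero, mul_comm]
    · rw [at', ← eval_det_eq_det_map_eval, hdet]
      simp [eval_prod]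

namespace IsE8

theorem natDegree_le (hd : d.IsE8) (i j : Fin 3) : (d.A i j).natDegree ≤ 3 :=
  (isE8_iff.1 hd).1 i j

theorem at'_zero (hd : d.IsE8) : d.at' 0 = 1 := (isE8_iff.1 hd).2.1

theorem map_coeff_three (hd : d.IsE8) :
    d.A.map (coeff · 3) = d.κ • (1 : Matrix (Fin 3) (Fin 3) ℂ) :=
  (isE8_iff.1 hd).2.2.1

theorem κ_pow_mul_prod_e (hd : d.IsE8) : d.κ ^ 3 * ∏ i, d.e i = 1 := by
  simpa [hd.at'_zero] using (hd.det_eq 0).symm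

theorem κ_ne_zero (hd : d.IsE8) : d.κ ≠ 0 := fun h => by
  simpa [h] using hd.κ_pow_mul_prod_e

theorem e_ne_zero (hd : d.IsE8) (i : Fin 9) : d.e i ≠ 0 := fun h => by
  simpa [Finset.prod_eq_zero (Finset.mem_univ i) h] using hd.κ_pow_mul_prod_e

theorem e₃_injective (hd : d.IsE8) : Function.Injective d.e₃ :=
  hd.distinct.comp (Fin.castLE_injective _)

theorem e₃_ne_zero (hd : d.IsE8) (i : Fin 3) : d.e₃ i ≠ 0 := hd.e_ne_zero _

theorem prod₃_ne_zero (hd : d.IsE8) : d.prod₃ ≠ 0 :=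
  Finset.prod_ne_zero_iff.2 fun i _ => hd.e₃_ne_zero i

theorem κ_mul_prod₃_ne_zero (hd : d.IsE8) : d.κ * d.prod₃ ≠ 0 :=
  mul_ne_zero hd.κ_ne_zero hd.prod₃_ne_zero

theorem separable_det (hd : d.IsE8) : d.A.det.Separable := by
  have hprod := separable_prod_X_sub_C_iff.2 (neg_injective.comp hd.distinct)
  simp only [Function.comp_apply, map_neg, sub_neg_eq_add] at hprod
  rw [(isE8_iff.1 hd).2.2.2.1]
  exact hprod.unit_mul (isUnit_C.2 (pow_ne_zero 3 hd.κ_ne_zero).isUnit)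

theorem det_at'_neg_e (hd : d.IsE8) (i : Fin 9) : (d.at' (-d.e i)).det = 0 := by
  rw [hd.det_eq, Finset.prod_eq_zero (Finset.mem_univ i) (neg_add_cancel _), mul_zero]

theorem finrank_ker_at'_neg_e (hd : d.IsE8) (i : Fin 9) :
    finrank ℂ (LinearMap.ker (d.at' (-d.e i)).toLin') = 1 := by
  refine le_antisymm (finrank_ker_map_eval_le_one hd.separable_det _)
    (Submodule.one_le_finrank_iff.2 fun hbot => ?_)
  obtain ⟨v, hv, hv0⟩ := Matrix.exists_mulVec_eq_zero_iff.2 (hd.det_at'_neg_e i)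
  exact hv ((Submodule.eq_bot_iff _).1 hbot v hv0)

end IsE8

/-- The value `q ^ λ = (κ e_1 e_2 e_3)⁻¹` of the parameter of the middle convolution. -/
def mcParam (d : QSystem) : ℂ := (d.κ * d.prod₃)⁻¹

/-- The `q`-number `[λ]` of the parameter `λ` with `q ^ λ = (κ e_1 e_2 e_3)⁻¹`. -/
def mcNumber (q : ℂ) (d : QSystem) : ℂ := (1 - d.mcParam) / (1 - q)

/-- The residues `A_1, A_2, A_3` of the gauge transform of `d`. -/
def residue (q : ℂ) (d : QSystem) (i : Fin 3) : Matrix (Fin 3) (Fin 3) ℂ :=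
  (residueFactor q d.e₃ i)⁻¹ • d.at' (-d.e₃ i)

/-- The system with the parameters of `s_0 . d` and with the residues `M_1, M_2, M_3` before the
gauge transformation. -/
def s0OfResidues (q : ℂ) (d : QSystem) (M : Fin 3 → Matrix (Fin 3) (Fin 3) ℂ) : QSystem where
  e i := if (i : ℕ) < 3 then d.e i else d.κ * d.prod₃ * d.e i
  κ := (d.κ * d.prod₃ ^ 2)⁻¹
  A := fuchsPoly q d.e₃ M

theorem IsE8.mcParam_ne_zero (hd : d.IsE8) : d.mcParam ≠ 0 := inv_ne_zero hd.κ_mul_prod₃_ne_zero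

theorem one_sub_mul_mcNumber (hq : q ≠ 1) : (1 - q) * d.mcNumber q = 1 - d.mcParam :=
  mul_div_cancel₀ _ (sub_ne_zero.2 hq.symm)

theorem IsE8.A_eq_fuchsPoly (hd : d.IsE8) (hq : q ≠ 1) :
    d.A = fuchsPoly q d.e₃ (d.residue q) :=
  eq_fuchsPoly_of_natDegree_le hq hd.e₃_injective hd.e₃_ne_zero
    (fun i j => (hd.natDegree_le i j).trans_eq (Fintype.card_fin 3).symm) hd.at'_zero

theorem IsE8.one_sub_smul_sum_residue (hd : d.IsE8) (hq : q ≠ 1) :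
    (1 - q) • ∑ i, d.residue q i = (1 - d.κ * d.prod₃) • 1 := by
  have h3 := map_coeff_card_fuchsPoly q d.e₃ (d.residue q)
  rw [← hd.A_eq_fuchsPoly hq, Fintype.card_fin, hd.map_coeff_three, ← prod₃,
    eq_inv_smul_iff₀ hd.prod₃_ne_zero, smul_smul, eq_sub_iff_add_eq', ← eq_sub_iff_add_eq] at h3
  rw [h3, sub_smul, one_smul, mul_comm]

theorem IsE8.mcParam_smul_sum_residue (hd : d.IsE8) (hq : q ≠ 1) :
    d.mcParam • ∑ i, (d.residue q i).toLin' = -d.mcNumber q • 1 := by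
  have hq' : 1 - q ≠ 0 := sub_ne_zero.2 hq.symm
  have hκ := hd.κ_ne_zero
  have hp := hd.prod₃_ne_zero
  rw [← map_sum, (eq_inv_smul_iff₀ hq').2 (hd.one_sub_smul_sum_residue hq), map_smul, map_smul,
    smul_smul, smul_smul, Matrix.toLin'_one]
  congr 1
  rw [mcNumber, mcParam]
  field_simp
  ring

end QSystem

section Gauge

variable {q : ℂ} {d : QSystem} {B : Fin 3 → Matrix (Fin 3) (Fin 3) ℂ} {x : ℂ}

theorem add_e₃_ne_zero_of_gaugeFun_ne_zero (hq : ‖q‖ < 1) (he : ∀ i, d.e₃ i ≠ 0)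
    (hx : gaugeFun q d x ≠ 0) (i : Fin 3) : x + d.e₃ i ≠ 0 := fun h => by
  rw [gaugeFun_eq_mul hq, ← eval_gaugePoly, eq_neg_of_add_eq_zero_left h,
    eval_neg_gaugePoly (he i), zero_mul] at hx
  exact hx rfl

theorem gauge_gaugeFun (hq : ‖q‖ < 1) (F : ℂ → Matrix (Fin 3) (Fin 3) ℂ)
    (hx : gaugeFun q d x ≠ 0) :
    gauge q (gaugeFun q d) F x = ((gaugePoly d.e₃).eval x)⁻¹ • F x := by
  have h := gaugeFun_eq_mul hq d x
  have hqx : gaugeFun q d (q * x) ≠ 0 := right_ne_zero_of_mul (h ▸ hx)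
  rw [gauge, h, ← eval_gaugePoly, div_mul_cancel_right₀ hqx]

theorem gauge_inv_gaugeFun (hq : ‖q‖ < 1) (F : ℂ → Matrix (Fin 3) (Fin 3) ℂ)
    (hx : gaugeFun q d x ≠ 0) :
    gauge q (fun z => (gaugeFun q d z)⁻¹) F x = (gaugePoly d.e₃).eval x • F x := by
  have h := gaugeFun_eq_mul hq d x
  have hqx : gaugeFun q d (q * x) ≠ 0 := right_ne_zero_of_mul (h ▸ hx)
  rw [gauge, inv_div_inv, h, ← eval_gaugePoly, mul_div_cancel_right₀ _ hqx]

theorem gauge_inv_gaugeFun_fuchsMatrix (hq : ‖q‖ < 1) (he : ∀ i, d.e₃ i ≠ 0)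
    (M : Fin 3 → Matrix (Fin 3) (Fin 3) ℂ) (hx : gaugeFun q d x ≠ 0) :
    gauge q (fun z => (gaugeFun q d z)⁻¹) (fuchsMatrix q d M) x =
      (fuchsPoly q d.e₃ M).map (eval x) := by
  rw [gauge_inv_gaugeFun hq _ hx, map_eval_fuchsPoly_of_add_ne_zero he M
    (add_e₃_ne_zero_of_gaugeFun_ne_zero hq he hx), fuchsMatrix]

theorem isResidueTuple_iff (hq : ‖q‖ < 1) (he : ∀ i, d.e₃ i ≠ 0) :
    IsResidueTuple q d B ↔ d.A = fuchsPoly q d.e₃ B := by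
  have hq1 : 1 - q ≠ 0 := sub_ne_zero.2 (ne_one_of_norm_lt_one hq).symm
  have hiff (x : ℂ) (hx : x ≠ 0 ∧ gaugeFun q d x ≠ 0) :
      ∑ i, (x + d.e₃ i)⁻¹ • B i = ((1 - q) * x)⁻¹ • (1 - gauge q (gaugeFun q d) d.at' x) ↔
        d.at' x = (fuchsPoly q d.e₃ B).map (eval x) := by
    have hne := add_e₃_ne_zero_of_gaugeFun_ne_zero hq he hx.2
    rw [gauge_gaugeFun hq _ hx.2, map_eval_fuchsPoly_of_add_ne_zero he B hne,
      eq_inv_smul_iff₀ (mul_ne_zero hq1 hx.1), eq_sub_iff_add_eq', ← eq_sub_iff_add_eq,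
      inv_smul_eq_iff₀ (eval_gaugePoly_ne_zero he hne)]
  exact ⟨fun h => eq_of_infinite_map_eval_eq (infinite_setOf_gaugeFun_ne_zero hq he) fun x hx =>
    (hiff x hx).1 (h x hx.1 hx.2), fun h x hx hgx => (hiff x ⟨hx, hgx⟩).2 (h ▸ rfl)⟩

theorem QSystem.IsE8.isResidueTuple_iff_eq_residue (hd : d.IsE8) (hq : ‖q‖ < 1) :
    IsResidueTuple q d B ↔ B = d.residue q := by
  have hq1 := ne_one_of_norm_lt_one hq
  rw [isResidueTuple_iff hq hd.e₃_ne_zero, hd.A_eq_fuchsPoly hq1,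
    (fuchsPoly_injective hq1 hd.e₃_injective hd.e₃_ne_zero).eq_iff, eq_comm]

end Gauge

theorem exists_cpow_eq {q c : ℂ} (hq0 : 0 < ‖q‖) (hq1 : ‖q‖ < 1) (hc : c ≠ 0) :
    ∃ lam : ℂ, q ^ lam = c := by
  have h0 : q ≠ 0 := norm_pos_iff.1 hq0
  have hlog : Complex.log q ≠ 0 := fun h => by
    rw [← Complex.exp_log h0, h, Complex.exp_zero] at hq1
    simp at hq1
  refine ⟨Complex.log c / Complex.log q, ?_⟩
  rw [Complex.cpow_def_of_ne_zero h0, mul_div_cancel₀ _ hlog, Complex.exp_log hc]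

namespace QSystem

/-- The systems that `s_0` transforms into systems of the same form: `κ e_i e_j e_k ≠ 1` for all
pairwise distinct `i, j, k` of which at most one is larger than `3`. -/
structure Admissible (d : QSystem) : Prop where
  isE8 : d.IsE8
  ne_one : d.κ * d.prod₃ ≠ 1
  ne_e : ∀ i j : Fin 9, (i : ℕ) < 3 → 3 ≤ (j : ℕ) → d.κ * d.prod₃ * d.e j ≠ d.e i

variable {q : ℂ} {d b : QSystem} {M : Fin 3 → Matrix (Fin 3) (Fin 3) ℂ}

theorem IsE8.admissible (hd : d.IsE8) (hres : d.NonResonant) : d.Admissible where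
  isE8 := hd
  ne_one h := hres 0 1 2 (by decide) (by decide) (by decide) <| by
    rw [← h, prod₃, Fin.prod_univ_three, ← mul_assoc, ← mul_assoc]
    rfl
  ne_e i j hi hj h := by
    obtain ⟨k, rfl⟩ : ∃ k : Fin 3, Fin.castLE (by norm_num) k = i := ⟨⟨i, hi⟩, rfl⟩
    have hprod : d.prod₃ = d.e₃ k * d.e₃ (k + 1) * d.e₃ (k + 2) := by
      rw [prod₃, Fin.prod_univ_three]
      fin_cases k <;> simp <;> ring
    have hne (l : Fin 3) : Fin.castLE (by norm_num) l ≠ j := fun hl => by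
      rw [← hl] at hj
      exact hj.not_gt l.2
    refine hres _ _ j ((Fin.castLE_injective (by norm_num)).ne (by simp : k + 1 ≠ k + 2)) (hne _)
      (hne _).symm (mul_right_cancel₀ (hd.e₃_ne_zero k) ?_)
    rw [one_mul]
    refine Eq.trans ?_ h
    rw [hprod]
    simp only [e₃]
    ring

theorem s0OfResidues_e_of_lt {i : Fin 9} (hi : (i : ℕ) < 3) : (d.s0OfResidues q M).e i = d.e i :=
  if_pos hi

theorem s0OfResidues_e_of_le {i : Fin 9} (hi : 3 ≤ (i : ℕ)) :
    (d.s0OfResidues q M).e i = d.κ * d.prod₃ * d.e i :=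
  if_neg hi.not_gt

theorem e₃_s0OfResidues : (d.s0OfResidues q M).e₃ = d.e₃ :=
  funext fun i => s0OfResidues_e_of_lt i.2

theorem prod₃_s0OfResidues : (d.s0OfResidues q M).prod₃ = d.prod₃ := by
  rw [prod₃, e₃_s0OfResidues, prod₃]

theorem IsE8.κ_mul_prod₃_s0OfResidues (hd : d.IsE8) :
    (d.s0OfResidues q M).κ * (d.s0OfResidues q M).prod₃ = (d.κ * d.prod₃)⁻¹ := by
  have := hd.κ_ne_zero
  have := hd.prod₃_ne_zero
  rw [prod₃_s0OfResidues, s0OfResidues]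
  field_simp

theorem IsE8.mcParam_s0OfResidues (hd : d.IsE8) :
    (d.s0OfResidues q M).mcParam = d.mcParam⁻¹ :=
  congrArg (·⁻¹) hd.κ_mul_prod₃_s0OfResidues

theorem IsE8.mcNumber_s0OfResidues (hd : d.IsE8) :
    (d.s0OfResidues q M).mcNumber q = -(d.mcParam⁻¹ * d.mcNumber q) := by
  rw [mcNumber, hd.mcParam_s0OfResidues, mcNumber, mul_div, mul_sub,
    inv_mul_cancel₀ hd.mcParam_ne_zero, ← neg_div]
  ring

theorem IsE8.s0OfResidues_s0OfResidues_e (hd : d.IsE8) (M' : Fin 3 → Matrix (Fin 3) (Fin 3) ℂ) :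
    ((d.s0OfResidues q M).s0OfResidues q M').e = d.e := by
  funext i
  rw [s0OfResidues, hd.κ_mul_prod₃_s0OfResidues, s0OfResidues]
  dsimp only
  split_ifs
  · rfl
  · rw [inv_mul_cancel_left₀ hd.κ_mul_prod₃_ne_zero]

theorem IsE8.s0OfResidues_s0OfResidues_κ (hd : d.IsE8) (M' : Fin 3 → Matrix (Fin 3) (Fin 3) ℂ) :
    ((d.s0OfResidues q M).s0OfResidues q M').κ = d.κ := by
  have := hd.prod₃_ne_zero
  rw [s0OfResidues, prod₃_s0OfResidues, s0OfResidues]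
  field_simp

theorem IsE8.residue_s0OfResidues (hd : d.IsE8) (hq : q ≠ 1) :
    (d.s0OfResidues q M).residue q = M := by
  funext i
  rw [residue, e₃_s0OfResidues, at', s0OfResidues, map_eval_neg_fuchsPoly hd.e₃_ne_zero,
    inv_smul_smul₀ (residueFactor_ne_zero hq hd.e₃_injective hd.e₃_ne_zero i)]

namespace Admissible

theorem mcNumber_ne_zero (hd : d.Admissible) (hq : q ≠ 1) : d.mcNumber q ≠ 0 := by
  refine div_ne_zero (sub_ne_zero.2 fun h => hd.ne_one ?_) (sub_ne_zero.2 hq.symm)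
  rw [← inv_inv (d.κ * d.prod₃), ← mcParam, ← h, inv_one]

theorem injective_s0OfResidues_e (hd : d.Admissible) (M : Fin 3 → Matrix (Fin 3) (Fin 3) ℂ) :
    Function.Injective (d.s0OfResidues q M).e := fun i j h => by
  simp only [s0OfResidues] at h
  split_ifs at h with hi hj hj
  · exact hd.isE8.distinct h
  · exact absurd h.symm (hd.ne_e i j hi (not_lt.1 hj))
  · exact absurd h (hd.ne_e j i hj (not_lt.1 hi))
  · exact hd.isE8.distinct (mul_left_cancel₀ hd.isE8.κ_mul_prod₃_ne_zero h)

theorem finrank_ker_residue (hd : d.Admissible) (hq : q ≠ 1) (i : Fin 3) :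
    finrank ℂ (LinearMap.ker (d.residue q i).toLin') = 1 := by
  rw [residue, map_smul, LinearMap.ker_smul _ _ (inv_ne_zero
    (residueFactor_ne_zero hq hd.isE8.e₃_injective hd.isE8.e₃_ne_zero i))]
  exact hd.isE8.finrank_ker_at'_neg_e _

theorem finrank_range_mcMap (hd : d.Admissible) (hq : q ≠ 1) :
    finrank ℂ (LinearMap.range
      (mcMap d.mcParam (d.mcNumber q) fun i => (d.residue q i).toLin')) = 3 := by
  have h := (mcMap d.mcParam (d.mcNumber q) fun i =>
    (d.residue q i).toLin').finrank_range_add_finrank_ker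
  rw [finrank_ker_mcMap (hd.mcNumber_ne_zero hq) (hd.isE8.mcParam_smul_sum_residue hq),
    Finset.sum_congr rfl fun i _ => hd.finrank_ker_residue hq i] at h
  simpa [finrank_pi_fintype] using h

end Admissible

end QSystem

section Transform

variable {q : ℂ} {d b : QSystem} {M : Fin 3 → Matrix (Fin 3) (Fin 3) ℂ}

theorem isS0_iff (hq0 : 0 < ‖q‖) (hq1 : ‖q‖ < 1) (hd : d.Admissible) :
    IsS0 q d b ↔ ∃ M : Fin 3 → Matrix (Fin 3) (Fin 3) ℂ,
      IsMC d.mcParam (d.mcNumber q) (fun i => (d.residue q i).toLin') (fun i => (M i).toLin') ∧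
        b = d.s0OfResidues q M := by
  have hq : q ≠ 1 := ne_one_of_norm_lt_one hq1
  have he := hd.isE8.e₃_ne_zero
  have hs := hd.mcNumber_ne_zero hq
  have hB := hd.isE8.mcParam_smul_sum_residue hq
  constructor
  · rintro ⟨hbe, hbκ, B, lam, ψ, hres, hlam, hbA⟩
    obtain rfl := (hd.isE8.isResidueTuple_iff_eq_residue hq1).1 hres
    have hnum : qNumber q lam = d.mcNumber q := congrArg (fun z => (1 - z) / (1 - q)) hlam
    rw [← QSystem.mcParam] at hlam
    rw [← hlam, ← hnum] at hB ⊢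
    rw [← hnum] at hs
    refine ⟨_, (isMC_iff_exists_eq_conj_qMC hs hB).2 ⟨ψ, fun i => Matrix.toLin'_toMatrix' _⟩, ?_⟩
    rcases b with ⟨e, κ, A⟩
    obtain rfl : e = _ := funext hbe
    obtain rfl : κ = _ := hbκ
    congr 1
    refine eq_of_infinite_map_eval_eq (infinite_setOf_gaugeFun_ne_zero hq1 he) fun x hx => ?_
    exact (hbA x hx.2).trans (gauge_inv_gaugeFun_fuchsMatrix hq1 he _ hx.2)
  · rintro ⟨M, hM, rfl⟩
    obtain ⟨lam, hlam⟩ := exists_cpow_eq hq0 hq1 hd.isE8.mcParam_ne_zero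
    have hnum : qNumber q lam = d.mcNumber q := congrArg (fun z => (1 - z) / (1 - q)) hlam
    rw [← hnum] at hs
    rw [← hlam, ← hnum] at hB hM
    obtain ⟨ψ, hψ⟩ := (isMC_iff_exists_eq_conj_qMC hs hB).1 hM
    refine ⟨fun _ => rfl, rfl, _, lam, ψ,
      (hd.isE8.isResidueTuple_iff_eq_residue hq1).2 rfl, hlam, fun x hx => ?_⟩
    simp only [← hψ, LinearMap.toMatrix'_toLin', gauge_inv_gaugeFun_fuchsMatrix hq1 he M hx]
    rfl

end Transform

section Conjugation

variable {K n : Type*} [Field K] [Fintype n] [DecidableEq n]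

/-- An invertible matrix as an automorphism of the space of column vectors. -/
def glEquiv : GL n K ≃* ((n → K) ≃ₗ[K] (n → K)) :=
  GeneralLinearGroup.toLin.trans (LinearMap.GeneralLinearGroup.generalLinearEquiv K (n → K))

theorem toLin'_inv_mul_mul (G : GL n K) (M : Matrix n n K) :
    toLin' ((↑G⁻¹ : Matrix n n K) * M * (G : Matrix n n K)) = (glEquiv G).symm.conj M.toLin' := by
  rw [toLin'_mul, toLin'_mul]
  rfl

theorem exists_eq_inv_mul_mul (F : (n → K) ≃ₗ[K] (n → K)) :
    ∃ G : GL n K, ∀ M N : Matrix n n K, N.toLin' = F.conj M.toLin' →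
      N = (↑G⁻¹ : Matrix n n K) * M * (G : Matrix n n K) := by
  refine ⟨glEquiv.symm F.symm, fun M N h => toLin'.injective ?_⟩
  rw [h, toLin'_inv_mul_mul, MulEquiv.apply_symm_apply, LinearEquiv.symm_symm]

end Conjugation

section Transform

variable {q : ℂ} {d d' b b' : QSystem} {M : Fin 3 → Matrix (Fin 3) (Fin 3) ℂ}

theorem exists_isS0 (hq0 : 0 < ‖q‖) (hq1 : ‖q‖ < 1) (hd : d.Admissible) : ∃ b, IsS0 q d b := by
  have hq : q ≠ 1 := ne_one_of_norm_lt_one hq1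
  obtain ⟨C, hC⟩ := exists_isMC (W := Fin 3 → ℂ)
    ((hd.finrank_range_mcMap hq).trans (finrank_fin_fun ℂ).symm)
  refine ⟨_, (isS0_iff hq0 hq1 hd).2 ⟨fun i => LinearMap.toMatrix' (C i), ?_, rfl⟩⟩
  simpa only [toLin'_toMatrix'] using hC

namespace QSystem.Admissible

theorem det_at'_s0OfResidues_eq_zero (hd : d.Admissible) (hq : q ≠ 1)
    (hM : IsMC d.mcParam (d.mcNumber q) (fun i => (d.residue q i).toLin') fun i => (M i).toLin')
    (i : Fin 9) : ((d.s0OfResidues q M).at' (-(d.s0OfResidues q M).e i)).det = 0 := by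
  have he := hd.isE8.e₃_ne_zero
  rcases lt_or_ge (i : ℕ) 3 with hi | hi
  · set k : Fin 3 := ⟨i, hi⟩
    have hker : LinearMap.ker (d.residue q k).toLin' ≠ ⊥ := fun h => by
      have h1 := hd.finrank_ker_residue hq k
      rw [h, finrank_bot] at h1
      exact zero_ne_one h1
    have hnot := hM.not_injective rfl hker
    have hval : (d.s0OfResidues q M).at' (-(d.s0OfResidues q M).e i) =
        residueFactor q d.e₃ k • M k := by
      rw [← map_eval_neg_fuchsPoly he, ← congrFun (e₃_s0OfResidues (q := q) (M := M)) k]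
      rfl
    rw [hval, det_smul, mul_eq_zero]
    right
    by_contra hdet
    exact hnot (mulVec_injective_of_isUnit ((isUnit_iff_isUnit_det _).2 (Ne.isUnit hdet)))
  · have hcx : d.mcParam * (-(d.s0OfResidues q M).e i) = -d.e i := by
      rw [s0OfResidues_e_of_le hi, mul_neg, mcParam,
        inv_mul_cancel_left₀ hd.isE8.κ_mul_prod₃_ne_zero]
    have hx (k : Fin 3) : -(d.s0OfResidues q M).e i + d.e₃ k ≠ 0 := fun h =>
      hd.ne_e _ i k.2 hi ((s0OfResidues_e_of_le hi).symm.trans (neg_add_eq_zero.1 h))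
    have hx' (k : Fin 3) : d.mcParam * (-(d.s0OfResidues q M).e i) + d.e₃ k ≠ 0 := fun h => by
      rw [hcx, neg_add_eq_zero] at h
      exact (k.2.trans_le hi).ne' (congrArg Fin.val (hd.isE8.distinct h))
    obtain ⟨v, hv0, hv⟩ := exists_mulVec_eq_zero_iff.2 (hd.isE8.det_at'_neg_e i)
    rw [at', hd.isE8.A_eq_fuchsPoly hq, ← hcx, map_eval_fuchsPoly_mulVec_eq_zero_iff he _ hx'] at hv
    obtain ⟨w, hw0, hw⟩ := hM.exists_eq_smul_sum (one_sub_mul_mcNumber hq) hx hx' hv0 hv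
    exact exists_mulVec_eq_zero_iff.1
      ⟨w, hw0, (map_eval_fuchsPoly_mulVec_eq_zero_iff he M hx w).2 hw⟩

theorem isE8_s0OfResidues (hd : d.Admissible) (hq : q ≠ 1)
    (hM : IsMC d.mcParam (d.mcNumber q) (fun i => (d.residue q i).toLin') fun i => (M i).toLin') :
    (d.s0OfResidues q M).IsE8 := by
  have hdeg (i j : Fin 3) : ((d.s0OfResidues q M).A i j).natDegree ≤ 3 :=
    (natDegree_fuchsPoly_le q d.e₃ M i j).trans_eq (Fintype.card_fin 3)
  have hsum : ∑ i, M i = d.mcNumber q • 1 := toLin'.injective <| by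
    rw [map_sum, map_smul, toLin'_one]
    exact hM.sum_eq (hd.mcNumber_ne_zero hq) (hd.isE8.mcParam_smul_sum_residue hq)
  have hcoeff : (d.s0OfResidues q M).A.map (coeff · 3) =
      (d.s0OfResidues q M).κ • (1 : Matrix (Fin 3) (Fin 3) ℂ) := by
    have hκ : d.prod₃⁻¹ * d.mcParam = (d.κ * d.prod₃ ^ 2)⁻¹ := by
      rw [mcParam, ← mul_inv]
      ring
    have h := map_coeff_card_fuchsPoly q d.e₃ M
    rw [Fintype.card_fin, ← prod₃, hsum, smul_smul, one_sub_mul_mcNumber hq, sub_smul, one_smul,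
      sub_sub_cancel, smul_smul, hκ] at h
    exact h
  refine isE8_iff.2 ⟨hdeg, map_eval_zero_fuchsPoly q d.e₃ M, hcoeff, ?_,
    hd.injective_s0OfResidues_e M⟩
  have hdet := eq_C_mul_prod_X_add_C (hd.injective_s0OfResidues_e M)
    ((natDegree_det_le hdeg).trans_eq (by simp)) fun i => by
      rw [eval_det_eq_det_map_eval]
      exact hd.det_at'_s0OfResidues_eq_zero hq hM i
  have hlead := coeff_det_of_natDegree_le hdeg
  rw [hcoeff, det_smul, det_one, mul_one, Fintype.card_fin] at hlead
  rw [hdet, ← hlead, Fintype.card_fin]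

theorem admissible_s0OfResidues (hd : d.Admissible) (hq : q ≠ 1)
    (hM : IsMC d.mcParam (d.mcNumber q) (fun i => (d.residue q i).toLin') fun i => (M i).toLin') :
    (d.s0OfResidues q M).Admissible where
  isE8 := hd.isE8_s0OfResidues hq hM
  ne_one h := hd.ne_one <| by
    rwa [hd.isE8.κ_mul_prod₃_s0OfResidues, inv_eq_one] at h
  ne_e i j hi hj := by
    rw [hd.isE8.κ_mul_prod₃_s0OfResidues, s0OfResidues_e_of_lt hi, s0OfResidues_e_of_le hj,
      inv_mul_cancel_left₀ hd.isE8.κ_mul_prod₃_ne_zero]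
    exact fun h => (hi.trans_le hj).ne' (congrArg Fin.val (hd.isE8.distinct h))

end QSystem.Admissible

theorem IsS0.admissible (hq0 : 0 < ‖q‖) (hq1 : ‖q‖ < 1) (hd : d.Admissible) (hb : IsS0 q d b) :
    b.Admissible := by
  obtain ⟨M, hM, rfl⟩ := (isS0_iff hq0 hq1 hd).1 hb
  exact hd.admissible_s0OfResidues (ne_one_of_norm_lt_one hq1) hM

theorem IsS0.conj_symm (hq0 : 0 < ‖q‖) (hq1 : ‖q‖ < 1) (hd : d.Admissible)
    (hstar : Star fun i => (d.residue q i).toLin')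
    (hstarstar : StarStar fun i => (d.residue q i).toLin') (hb : IsS0 q d b)
    (hb' : IsS0 q b b') : b'.Conj d := by
  have hq : q ≠ 1 := ne_one_of_norm_lt_one hq1
  have had := hb.admissible hq0 hq1 hd
  obtain ⟨M, hM, rfl⟩ := (isS0_iff hq0 hq1 hd).1 hb
  obtain ⟨M', hM', rfl⟩ := (isS0_iff hq0 hq1 had).1 hb'
  rw [hd.isE8.residue_s0OfResidues hq, hd.isE8.mcParam_s0OfResidues,
    hd.isE8.mcNumber_s0OfResidues] at hM'
  obtain ⟨F, hF⟩ := hM'.exists_conj <| hM.symm (hd.mcNumber_ne_zero hq)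
    (hd.isE8.mcParam_smul_sum_residue hq) hstar hstarstar
    (inv_mul_cancel₀ hd.isE8.mcParam_ne_zero) rfl
  obtain ⟨G, hG⟩ := exists_eq_inv_mul_mul F
  refine ⟨hd.isE8.s0OfResidues_s0OfResidues_e M', hd.isE8.s0OfResidues_s0OfResidues_κ M', G,
    fun x => ?_⟩
  rw [QSystem.at', QSystem.at', hd.isE8.A_eq_fuchsPoly hq,
    funext fun i => hG (M' i) (d.residue q i) (hF i), map_eval_fuchsPoly_conj,
    ← QSystem.e₃_s0OfResidues (q := q) (M := M)]
  rfl

end Transform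

namespace QSystem

variable {q : ℂ} {d d' : QSystem} {π : Equiv.Perm (Fin 9)}

/-- The system `d` with relabelled parameters; `swap i` is the case of a transposition. -/
def relabel (π : Equiv.Perm (Fin 9)) (d : QSystem) : QSystem := { d with e := d.e ∘ π }

theorem Conj.refl (d : QSystem) : d.Conj d := ⟨rfl, rfl, 1, fun x => by simp⟩

theorem Conj.symm (h : d.Conj d') : d'.Conj d := by
  obtain ⟨he, hκ, G, hG⟩ := h
  refine ⟨he.symm, hκ.symm, G⁻¹, fun x => ?_⟩
  rw [← hG, inv_inv, mul_assoc, Units.mul_inv_cancel_right, Units.mul_inv_cancel_left]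

theorem Conj.e₃_eq (h : d.Conj d') : d.e₃ = d'.e₃ := by
  unfold e₃
  rw [h.1]

theorem Conj.prod₃_eq (h : d.Conj d') : d.prod₃ = d'.prod₃ := by rw [prod₃, h.e₃_eq, prod₃]

theorem IsE8.of_conj (hd : d.IsE8) (h : d.Conj d') : d'.IsE8 := by
  obtain ⟨he, hκ, G, hG⟩ := h
  obtain ⟨⟨A₁, A₂, hA⟩, hdet, hinj⟩ := hd
  refine ⟨⟨(↑G⁻¹ : Matrix _ _ ℂ) * A₁ * G.1, (↑G⁻¹ : Matrix _ _ ℂ) * A₂ * G.1, fun x => ?_⟩,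
    fun x => ?_, he ▸ hinj⟩
  · rw [← hG, hA, ← hκ]
    simp only [mul_add, add_mul, Matrix.mul_smul, Matrix.smul_mul, mul_one, Units.inv_mul]
  · rw [← hG, det_units_conj', hdet, he, hκ]

theorem exists_e₃_relabel (hπ : ∀ j, (π j : ℕ) < 3 ↔ (j : ℕ) < 3) :
    ∃ τ : Equiv.Perm (Fin 3), ∀ d : QSystem, (d.relabel π).e₃ = d.e₃ ∘ τ := by
  have hinj : Function.Injective fun k : Fin 3 =>
      (⟨π (k.castLE (by norm_num)), (hπ _).2 k.2⟩ : Fin 3) := fun k l h =>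
    Fin.castLE_injective _ (π.injective (Fin.ext (Fin.mk.inj h)))
  exact ⟨Equiv.ofBijective _ (Finite.injective_iff_bijective.1 hinj), fun d => rfl⟩

theorem prod₃_relabel (hπ : ∀ j, (π j : ℕ) < 3 ↔ (j : ℕ) < 3) (d : QSystem) :
    (d.relabel π).prod₃ = d.prod₃ := by
  obtain ⟨τ, hτ⟩ := exists_e₃_relabel hπ
  rw [prod₃, hτ]
  exact Equiv.prod_comp τ d.e₃

theorem IsE8.relabel (hd : d.IsE8) (π : Equiv.Perm (Fin 9)) : (d.relabel π).IsE8 :=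
  ⟨hd.form, fun x => (hd.det_eq x).trans (congrArg _ (Equiv.prod_comp π (x + d.e ·)).symm),
    hd.distinct.comp π.injective⟩

namespace Admissible

theorem relabel (hd : d.Admissible) (hπ : ∀ j, (π j : ℕ) < 3 ↔ (j : ℕ) < 3) :
    (d.relabel π).Admissible where
  isE8 := hd.isE8.relabel π
  ne_one := by
    rw [prod₃_relabel hπ]
    exact hd.ne_one
  ne_e i j hi hj := by
    rw [prod₃_relabel hπ]
    exact hd.ne_e _ _ ((hπ i).2 hi) (not_lt.1 fun h => hj.not_gt ((hπ j).1 h))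

theorem of_conj (hd : d.Admissible) (h : d.Conj d') : d'.Admissible where
  isE8 := hd.isE8.of_conj h
  ne_one := by
    rw [← h.prod₃_eq, ← h.2.1]
    exact hd.ne_one
  ne_e := by
    rw [← h.prod₃_eq, ← h.2.1, ← h.1]
    exact hd.ne_e

end Admissible

end QSystem

theorem IsS0.conj_relabel {q : ℂ} {d d' b b' : QSystem} {π : Equiv.Perm (Fin 9)} (hq0 : 0 < ‖q‖)
    (hq1 : ‖q‖ < 1) (hd : d.Admissible) (hπ : ∀ j, (π j : ℕ) < 3 ↔ (j : ℕ) < 3)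
    (h : (d.relabel π).Conj d') (hb : IsS0 q d b) (hb' : IsS0 q d' b') :
    (b.relabel π).Conj b' := by
  have hd' := (hd.relabel hπ).of_conj h
  obtain ⟨M, hM, rfl⟩ := (isS0_iff hq0 hq1 hd).1 hb
  obtain ⟨M', hM', rfl⟩ := (isS0_iff hq0 hq1 hd').1 hb'
  obtain ⟨τ, hτ⟩ := QSystem.exists_e₃_relabel hπ
  have he : d.e ∘ π = d'.e := h.1
  have hκ : d.κ = d'.κ := h.2.1
  have he₃ : d'.e₃ = d.e₃ ∘ τ := h.e₃_eq.symm.trans (hτ d)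
  have hprod : d'.prod₃ = d.prod₃ := h.prod₃_eq.symm.trans (QSystem.prod₃_relabel hπ d)
  obtain ⟨-, -, G, hG⟩ := h
  have hres (i : Fin 3) : (d'.residue q i).toLin' =
      (glEquiv G).symm.conj (d.residue q (τ i)).toLin' := by
    rw [← toLin'_inv_mul_mul, QSystem.residue, QSystem.residue, he₃, residueFactor_comp, ← hG,
      Matrix.mul_smul, Matrix.smul_mul]
    rfl
  have hparam : d'.mcParam = d.mcParam := by
    rw [QSystem.mcParam, hprod, ← hκ, QSystem.mcParam]
  rw [funext hres, hparam, QSystem.mcNumber, hparam, ← QSystem.mcNumber] at hM'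
  obtain ⟨F, hF⟩ := ((hM.comp_perm τ).conj (glEquiv G).symm).exists_conj hM'
  obtain ⟨H, hH⟩ := exists_eq_inv_mul_mul F
  refine ⟨funext fun j => ?_, ?_, H, fun x => ?_⟩
  · simp only [QSystem.s0OfResidues, QSystem.relabel, Function.comp_apply, hπ, hprod, ← he, ← hκ]
  · simp only [QSystem.s0OfResidues, QSystem.relabel, hprod, hκ]
  · have hA : (d'.s0OfResidues q M').A =
        fuchsPoly q (d.e₃ ∘ τ) fun i => (↑H⁻¹ : Matrix _ _ ℂ) * (M ∘ τ) i * H.1 := by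
      rw [QSystem.s0OfResidues, he₃, funext fun i => hH ((M ∘ τ) i) (M' i) (hF i)]
    rw [QSystem.at', QSystem.at', hA, map_eval_fuchsPoly_conj, fuchsPoly_comp]
    rfl

section RegularFunctions

variable {K T σ : Type*} [Field K] {x : T → σ → K} {t₀ : T}

/-- The functions on `T` given by rational functions of the coordinates `x` that are regular at
`t₀`. A fraction `p / Δ` is encoded by the identity `F Δ = p`, which also has to hold at the zeros
of `Δ`. -/
def regularAt (x : T → σ → K) (t₀ : T) : Subalgebra K (T → K) where
  carrier := {F | ∃ p Δ : MvPolynomial σ K, MvPolynomial.eval (x t₀) Δ ≠ 0 ∧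
    ∀ t, F t * MvPolynomial.eval (x t) Δ = MvPolynomial.eval (x t) p}
  mul_mem' := by
    rintro F G ⟨p, Δ, h₀, h⟩ ⟨p', Δ', h₀', h'⟩
    refine ⟨p * p', Δ * Δ', by simp [h₀, h₀'], fun t => ?_⟩
    rw [map_mul, map_mul, ← h, ← h', Pi.mul_apply]
    ring
  add_mem' := by
    rintro F G ⟨p, Δ, h₀, h⟩ ⟨p', Δ', h₀', h'⟩
    refine ⟨p * Δ' + p' * Δ, Δ * Δ', by simp [h₀, h₀'], fun t => ?_⟩
    rw [map_add, map_mul, map_mul, map_mul, ← h, ← h', Pi.add_apply]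
    ring
  algebraMap_mem' c := ⟨MvPolynomial.C c, 1, by simp, fun t => by simp⟩

theorem coordinate_mem_regularAt (x : T → σ → K) (t₀ : T) (v : σ) :
    (fun t => x t v) ∈ regularAt x t₀ :=
  ⟨MvPolynomial.X v, 1, by simp, fun t => by simp⟩

theorem inv_mem_regularAt {F : T → K} (hF : F ∈ regularAt x t₀) (h₀ : F t₀ ≠ 0) :
    (fun t => (F t)⁻¹) ∈ regularAt x t₀ := by
  obtain ⟨p, Δ, hΔ, h⟩ := hF
  refine ⟨Δ * p, p ^ 2, ?_, fun t => ?_⟩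
  · rw [map_pow, ← h]
    exact pow_ne_zero 2 (mul_ne_zero h₀ hΔ)
  · rw [map_mul, map_pow, ← h]
    by_cases hFt : F t = 0
    · simp [hFt]
    · field_simp

theorem exists_eval_ne_zero_imp_of_mem_regularAt {F : T → K} (hF : F ∈ regularAt x t₀)
    (h₀ : F t₀ ≠ 0) : ∃ Δ : MvPolynomial σ K, MvPolynomial.eval (x t₀) Δ ≠ 0 ∧
      ∀ t, MvPolynomial.eval (x t) Δ ≠ 0 → F t ≠ 0 := by
  obtain ⟨p, Δ, hΔ, h⟩ := hF
  exact ⟨p, h t₀ ▸ mul_ne_zero h₀ hΔ, fun t ht => left_ne_zero_of_mul (h t ▸ ht)⟩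

theorem exists_common_denominator {ι : Type*} [Finite ι] {F : ι → T → K}
    (hF : ∀ i, F i ∈ regularAt x t₀) :
    ∃ (P : ι → MvPolynomial σ K) (Δ : MvPolynomial σ K), MvPolynomial.eval (x t₀) Δ ≠ 0 ∧
      ∀ i t, F i t * MvPolynomial.eval (x t) Δ = MvPolynomial.eval (x t) (P i) := by
  classical
  cases nonempty_fintype ι
  choose p Δ hΔ h using hF
  refine ⟨fun i => p i * ∏ j ∈ Finset.univ.erase i, Δ j, ∏ j, Δ j, ?_, fun i t => ?_⟩
  · rw [map_prod]
    exact Finset.prod_ne_zero_iff.2 fun j _ => hΔ j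
  · rw [← Finset.mul_prod_erase _ _ (Finset.mem_univ i), map_mul, map_mul, ← mul_assoc, h]

end RegularFunctions

section RegularMaps

variable {K T n V W U : Type*} [Field K] {D : Subalgebra K (T → K)}
  [AddCommGroup V] [Module K V] [AddCommGroup W] [Module K W] [AddCommGroup U] [Module K U]

theorem sum_apply_mem {ι : Type*} {s : Finset ι} {F : ι → T → K} (hF : ∀ i ∈ s, F i ∈ D) :
    (fun t => ∑ i ∈ s, F i t) ∈ D := by
  rw [← Finset.sum_fn]
  exact D.sum_mem hF

theorem prod_apply_mem {ι : Type*} {s : Finset ι} {F : ι → T → K} (hF : ∀ i ∈ s, F i ∈ D) :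
    (fun t => ∏ i ∈ s, F i t) ∈ D := by
  rw [← Finset.prod_fn]
  exact D.prod_mem hF

/-- The vector-valued functions on `T` whose coordinates lie in `D`. -/
def RegularVec (D : Subalgebra K (T → K)) (v : T → V) : Prop :=
  ∀ φ : Dual K V, (fun t => φ (v t)) ∈ D

/-- The families of linear maps, parametrized by `T`, whose matrix entries lie in `D`; without
reference to bases, those that preserve `RegularVec`. -/
def RegularMap (D : Subalgebra K (T → K)) (L : T → V →ₗ[K] W) : Prop :=
  ∀ v : T → V, RegularVec D v → RegularVec D fun t => L t (v t)

theorem RegularVec.add {v w : T → V} (hv : RegularVec D v) (hw : RegularVec D w) :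
    RegularVec D fun t => v t + w t := fun φ => by
  simp only [map_add]
  exact D.add_mem (hv φ) (hw φ)

theorem RegularVec.sum {ι : Type*} [Fintype ι] {v : ι → T → V} (hv : ∀ i, RegularVec D (v i)) :
    RegularVec D fun t => ∑ i, v i t := fun φ => by
  simp only [map_sum]
  exact sum_apply_mem fun i _ => hv i φ

theorem RegularVec.smul {F : T → K} {v : T → V} (hF : F ∈ D) (hv : RegularVec D v) :
    RegularVec D fun t => F t • v t := fun φ => by
  simp only [map_smul]
  exact D.mul_mem hF (hv φ)

theorem regularVec_const (v : V) : RegularVec D fun _ => v := fun φ => D.algebraMap_mem (φ v)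

theorem regularMap_const (L : V →ₗ[K] W) : RegularMap D fun _ => L := fun _ hv φ => hv (φ ∘ₗ L)

theorem RegularVec.pi {ι : Type*} [Finite ι] {v : ι → T → V}
    (hv : ∀ i, RegularVec D (v i)) : RegularVec D fun t i => v i t := by
  classical
  cases nonempty_fintype ι
  have hsum (t : T) : (fun i => v i t) = ∑ i, LinearMap.single K (fun _ => V) i (v i t) :=
    (Finset.univ_sum_single fun i => v i t).symm
  rw [funext hsum]
  exact .sum fun i => regularMap_const _ _ (hv i)

theorem RegularVec.apply {ι : Type*} {v : T → ι → V} (hv : RegularVec D v) (i : ι) :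
    RegularVec D fun t => v t i :=
  regularMap_const (LinearMap.proj i) _ hv

theorem RegularMap.comp {L : T → W →ₗ[K] U} {L' : T → V →ₗ[K] W} (hL : RegularMap D L)
    (hL' : RegularMap D L') : RegularMap D fun t => L t ∘ₗ L' t :=
  fun v hv => hL _ (hL' v hv)

theorem regularMap_toLin' [Fintype n] [DecidableEq n] {M : T → Matrix n n K}
    (hM : ∀ a b, (fun t => M t a b) ∈ D) : RegularMap D fun t => (M t).toLin' := fun _ hv =>
  .pi fun a => .sum fun b => .smul (hM a b) (hv.apply b)

theorem RegularMap.toMatrix'_mem [Fintype n] [DecidableEq n] {L : T → End K (n → K)}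
    (hL : RegularMap D L) (a b : n) : (fun t => LinearMap.toMatrix' (L t) a b) ∈ D := by
  simp only [LinearMap.toMatrix'_apply]
  exact hL _ (regularVec_const _) (LinearMap.proj a)

theorem det_mem [Fintype n] [DecidableEq n] {M : T → Matrix n n K}
    (hM : ∀ a b, (fun t => M t a b) ∈ D) : (fun t => (M t).det) ∈ D := by
  simp only [det_apply']
  exact sum_apply_mem fun π _ => mul_mem (D.algebraMap_mem _) (prod_apply_mem fun i _ => hM _ _)

theorem adjugate_mem [Fintype n] [DecidableEq n] {M : T → Matrix n n K}
    (hM : ∀ a b, (fun t => M t a b) ∈ D) (a b : n) : (fun t => (M t).adjugate a b) ∈ D := by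
  simp only [adjugate_apply]
  refine det_mem fun i j => ?_
  simp only [updateRow_apply]
  split_ifs
  exacts [D.algebraMap_mem ((Pi.single a 1 : n → K) j), hM i j]

theorem inv_matrix_mem_regularAt {σ : Type*} {x : T → σ → K} {t₀ : T} [Fintype n] [DecidableEq n]
    {M : T → Matrix n n K} (hM : ∀ a b, (fun t => M t a b) ∈ regularAt x t₀)
    (h₀ : (M t₀).det ≠ 0) (a b : n) : (fun t => (M t)⁻¹ a b) ∈ regularAt x t₀ := by
  simp only [inv_def, Ring.inverse_eq_inv', Matrix.smul_apply, smul_eq_mul]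
  exact mul_mem (inv_mem_regularAt (det_mem hM) h₀) (adjugate_mem hM a b)

section MiddleConvolution

variable {ι : Type*} [Fintype ι] {c s : T → K} {B : T → ι → End K V}

theorem regularMap_convRow (hc : c ∈ D) (hs : s ∈ D) (hB : ∀ i, RegularMap D fun t => B t i)
    (i : ι) : RegularMap D fun t => convRow (c t) (s t) (B t) i := fun v hv => by
  simp only [convRow_apply]
  exact .add (.smul hc (.sum fun j => hB j _ (hv.apply j))) (.smul hs (hv.apply i))

theorem regularMap_mcMap (hc : c ∈ D) (hs : s ∈ D) (hB : ∀ i, RegularMap D fun t => B t i) :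
    RegularMap D fun t => mcMap (c t) (s t) (B t) := fun v hv =>
  .pi fun i => hB i _ (regularMap_convRow hc hs hB i v hv)

theorem regularMap_mcChart [DecidableEq ι] (hc : c ∈ D) (hs : s ∈ D)
    (hB : ∀ i, RegularMap D fun t => B t i) (ρ : (ι → V) →ₗ[K] W) (σ : W →ₗ[K] ι → V)
    {N : T → End K W} (hN : RegularMap D N) (i : ι) :
    RegularMap D fun t => mcChart (c t) (s t) (B t) ρ σ (N t) i :=
  (regularMap_const ρ).comp <| (regularMap_mcMap hc hs hB).comp <| (regularMap_const _).comp <|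
    (regularMap_convRow hc hs hB i).comp <| (regularMap_const σ).comp hN

end MiddleConvolution

end RegularMaps

section RegularPolynomials

variable {K T : Type*} [Field K] {D : Subalgebra K (T → K)}

/-- The families of polynomials, parametrized by `T`, with coefficients in `D`. -/
def regularPoly (D : Subalgebra K (T → K)) : Subalgebra K (T → K[X]) where
  carrier := {P | ∀ k, (fun t => (P t).coeff k) ∈ D}
  mul_mem' {P Q} hP hQ k := by
    simp only [Pi.mul_apply, coeff_mul]
    exact sum_apply_mem fun m _ => D.mul_mem (hP m.1) (hQ m.2)
  add_mem' {P Q} hP hQ k := by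
    simp only [Pi.add_apply, coeff_add]
    exact D.add_mem (hP k) (hQ k)
  algebraMap_mem' c k := D.algebraMap_mem ((algebraMap K K[X] c).coeff k)

theorem const_mem_regularPoly (P : K[X]) : (fun _ => P) ∈ regularPoly D := fun k =>
  D.algebraMap_mem (P.coeff k)

theorem C_mem_regularPoly {F : T → K} (hF : F ∈ D) : (fun t => C (F t)) ∈ regularPoly D :=
  fun k => by
    simp only [coeff_C]
    split_ifs
    exacts [hF, D.zero_mem]

theorem fuchsPoly_mem_regularPoly {ι n : Type*} [Fintype ι] [DecidableEq ι] [DecidableEq n]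
    (q : K) {e : T → ι → K} {M : T → ι → Matrix n n K} (he : ∀ i, (fun t => (e t i)⁻¹) ∈ D)
    (hM : ∀ i a b, (fun t => M t i a b) ∈ D) (a b : n) :
    (fun t => fuchsPoly q (e t) (M t) a b) ∈ regularPoly D := by
  have hfactor (i : ι) : (fun t => 1 + C (e t i)⁻¹ * X) ∈ regularPoly D :=
    add_mem (one_mem _) (mul_mem (C_mem_regularPoly (he i)) (const_mem_regularPoly X))
  have hprod (s : Finset ι) : (fun t => ∏ i ∈ s, (1 + C (e t i)⁻¹ * X)) ∈ regularPoly D := by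
    rw [← Finset.prod_fn]
    exact prod_mem fun i _ => hfactor i
  have hsum : (fun t => ∑ i, gaugeCofactor (e t) i * C (M t i a b)) ∈ regularPoly D := by
    rw [← Finset.sum_fn]
    exact sum_mem fun i _ => mul_mem (mul_mem (C_mem_regularPoly (he i)) (hprod _))
      (C_mem_regularPoly (hM i a b))
  simp only [fuchsPoly_apply]
  exact sub_mem (mul_mem (hprod _) (const_mem_regularPoly _))
    (mul_mem (const_mem_regularPoly _) hsum)

end RegularPolynomials

namespace QSystem

variable {q : ℂ} {t₀ : {d : QSystem // d.IsE8}}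

/-- The functions of a system that are rational in its coordinates and regular at `t₀`. -/
abbrev regularFun (t₀ : {d : QSystem // d.IsE8}) : Subalgebra ℂ ({d : QSystem // d.IsE8} → ℂ) :=
  regularAt (fun t => t.1.coord) t₀

theorem coord_mem_regularFun (v : Coord) : (fun t => t.1.coord v) ∈ regularFun t₀ :=
  coordinate_mem_regularAt (fun t : {d : QSystem // d.IsE8} => t.1.coord) t₀ v

theorem e_mem_regularFun (i : Fin 9) : (fun t => t.1.e i) ∈ regularFun t₀ :=
  coord_mem_regularFun (.inr (.inl i))

theorem κ_mem_regularFun : (fun t => t.1.κ) ∈ regularFun t₀ :=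
  coord_mem_regularFun (.inr (.inr ()))

theorem coeff_A_mem_regularFun (i j : Fin 3) (k : ℕ) :
    (fun t => (t.1.A i j).coeff k) ∈ regularFun t₀ := by
  match k with
  | 0 =>
    have h0 (t : {d : QSystem // d.IsE8}) :
        (t.1.A i j).coeff 0 = (1 : Matrix (Fin 3) (Fin 3) ℂ) i j := by
      rw [coeff_zero_eq_eval_zero, ← t.2.at'_zero]
      rfl
    rw [funext h0]
    exact (regularFun t₀).algebraMap_mem _
  | 1 => exact coord_mem_regularFun (.inl (0, i, j))
  | 2 => exact coord_mem_regularFun (.inl (1, i, j))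
  | 3 =>
    have h3 (t : {d : QSystem // d.IsE8}) :
        (t.1.A i j).coeff 3 = t.1.κ * (1 : Matrix (Fin 3) (Fin 3) ℂ) i j :=
      congrFun (congrFun t.2.map_coeff_three i) j
    rw [funext h3]
    exact mul_mem κ_mem_regularFun ((regularFun t₀).algebraMap_mem _)
  | k + 4 =>
    have h4 (t : {d : QSystem // d.IsE8}) : (t.1.A i j).coeff (k + 4) = 0 :=
      coeff_eq_zero_of_natDegree_lt ((t.2.natDegree_le i j).trans_lt (by lia))
    rw [funext h4]
    exact zero_mem _

theorem at'_mem_regularFun {x : {d : QSystem // d.IsE8} → ℂ} (hx : x ∈ regularFun t₀)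
    (i j : Fin 3) : (fun t => t.1.at' (x t) i j) ∈ regularFun t₀ := by
  have hsum (t : {d : QSystem // d.IsE8}) : t.1.at' (x t) i j =
      ∑ k ∈ Finset.range 4, (t.1.A i j).coeff k * x t ^ k :=
    eval_eq_sum_range' (Nat.lt_succ_of_le (t.2.natDegree_le i j)) _
  rw [funext hsum]
  exact sum_apply_mem fun k _ => mul_mem (coeff_A_mem_regularFun i j k) (pow_mem hx k)

theorem inv_e₃_mem_regularFun (i : Fin 3) : (fun t => (t.1.e₃ i)⁻¹) ∈ regularFun t₀ :=
  inv_mem_regularAt (e_mem_regularFun _) (t₀.2.e₃_ne_zero i)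

theorem prod₃_mem_regularFun : (fun t => t.1.prod₃) ∈ regularFun t₀ :=
  prod_apply_mem fun _ _ => e_mem_regularFun _

theorem mcParam_mem_regularFun : (fun t => t.1.mcParam) ∈ regularFun t₀ :=
  inv_mem_regularAt (mul_mem κ_mem_regularFun prod₃_mem_regularFun) t₀.2.κ_mul_prod₃_ne_zero

theorem mcNumber_mem_regularFun : (fun t => t.1.mcNumber q) ∈ regularFun t₀ := by
  simp only [mcNumber, div_eq_mul_inv]
  exact mul_mem (sub_mem (one_mem _) mcParam_mem_regularFun) ((regularFun t₀).algebraMap_mem _)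

theorem residue_mem_regularFun (hq : q ≠ 1) (i a b : Fin 3) :
    (fun t => t.1.residue q i a b) ∈ regularFun t₀ := by
  have hfactor : (fun t => residueFactor q t.1.e₃ i) ∈ regularFun t₀ := by
    simp only [residueFactor, div_eq_mul_inv]
    exact mul_mem ((regularFun t₀).algebraMap_mem _) <| prod_apply_mem fun j _ =>
      sub_mem (one_mem _) (mul_mem (e_mem_regularFun _) (inv_e₃_mem_regularFun j))
  exact mul_mem (inv_mem_regularAt hfactor
    (residueFactor_ne_zero hq t₀.2.e₃_injective t₀.2.e₃_ne_zero i))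
    (at'_mem_regularFun (neg_mem (e_mem_regularFun _)) a b)

theorem coord_s0OfResidues_mem_regularFun
    {M : {d : QSystem // d.IsE8} → Fin 3 → Matrix (Fin 3) (Fin 3) ℂ}
    (hM : ∀ i a b, (fun t => M t i a b) ∈ regularFun t₀) (v : Coord) :
    (fun t => (t.1.s0OfResidues q (M t)).coord v) ∈ regularFun t₀ := by
  match v with
  | .inl (k, i, j) => exact fuchsPoly_mem_regularPoly q inv_e₃_mem_regularFun hM i j _
  | .inr (.inl i) =>
    simp only [coord, s0OfResidues]
    split_ifs
    · exact e_mem_regularFun i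
    · exact mul_mem (mul_mem κ_mem_regularFun prod₃_mem_regularFun) (e_mem_regularFun i)
  | .inr (.inr _) =>
    exact inv_mem_regularAt (mul_mem κ_mem_regularFun (pow_mem prod₃_mem_regularFun 2))
      (mul_ne_zero t₀.2.κ_ne_zero (pow_ne_zero 2 t₀.2.prod₃_ne_zero))

/-- Linear maps `ρ` and `σ` that make `ρ ∘ mcMap ∘ σ` invertible at `d` make it invertible near `d`;
they are kept fixed, and `mcChart` is then rational in the coordinates. -/
theorem Admissible.exists_regular_isMC {d : QSystem} (hd : d.Admissible) (hq : q ≠ 1) :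
    ∃ (M : {d : QSystem // d.IsE8} → Fin 3 → Matrix (Fin 3) (Fin 3) ℂ)
      (F : {d : QSystem // d.IsE8} → ℂ), (∀ i a b, (fun t => M t i a b) ∈ regularFun ⟨d, hd.isE8⟩) ∧
      F ∈ regularFun ⟨d, hd.isE8⟩ ∧ F ⟨d, hd.isE8⟩ ≠ 0 ∧ ∀ t, t.1.Admissible → F t ≠ 0 →
        IsMC t.1.mcParam (t.1.mcNumber q) (fun i => (t.1.residue q i).toLin')
          fun i => (M t i).toLin' := by
  let t₀ : {d : QSystem // d.IsE8} := ⟨d, hd.isE8⟩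
  let B (t : {d : QSystem // d.IsE8}) (i : Fin 3) := (t.1.residue q i).toLin'
  have hB (i : Fin 3) : RegularMap (regularFun t₀) fun t => B t i :=
    regularMap_toLin' (residue_mem_regularFun hq i)
  obtain ⟨ρ, σ, hρσ⟩ := exists_comp_comp_eq_id (W := Fin 3 → ℂ)
    ((hd.finrank_range_mcMap hq).trans (finrank_fin_fun ℂ).symm)
  let R (t : {d : QSystem // d.IsE8}) :=
    LinearMap.toMatrix' (ρ ∘ₗ mcMap t.1.mcParam (t.1.mcNumber q) (B t) ∘ₗ σ)
  have hR (a b : Fin 3) : (fun t => R t a b) ∈ regularFun t₀ :=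
    ((regularMap_const ρ).comp ((regularMap_mcMap mcParam_mem_regularFun mcNumber_mem_regularFun
      hB).comp (regularMap_const σ))).toMatrix'_mem a b
  have hR₀ : (R t₀).det ≠ 0 := by
    have h1 : R t₀ = 1 := (congrArg LinearMap.toMatrix' hρσ).trans LinearMap.toMatrix'_id
    rw [h1, det_one]
    exact one_ne_zero
  have hN : RegularMap (regularFun t₀) fun t => ((R t)⁻¹).toLin' :=
    regularMap_toLin' (inv_matrix_mem_regularAt hR hR₀)
  refine ⟨fun t i => LinearMap.toMatrix' (mcChart t.1.mcParam (t.1.mcNumber q) (B t) ρ σ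
    ((R t)⁻¹).toLin' i), fun t => (R t).det, fun i => (regularMap_mcChart mcParam_mem_regularFun
      mcNumber_mem_regularFun hB ρ σ hN i).toMatrix'_mem, det_mem hR, hR₀, fun t ht hdet => ?_⟩
  simp only [toLin'_toMatrix']
  refine isMC_mcChart ((ht.finrank_range_mcMap hq).trans (finrank_fin_fun ℂ).symm) ?_
  rw [← toLin'_toMatrix' (ρ ∘ₗ _ ∘ₗ σ), ← toLin'_mul, mul_nonsing_inv _ hdet.isUnit, toLin'_one]

end QSystem

theorem QSystem.Admissible.s0RationalAt {q : ℂ} {d : QSystem} (hq0 : 0 < ‖q‖) (hq1 : ‖q‖ < 1)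
    (hd : d.Admissible) : S0RationalAt q d := by
  have hq : q ≠ 1 := ne_one_of_norm_lt_one hq1
  obtain ⟨M, F, hM, hF, hF₀, hMC⟩ := hd.exists_regular_isMC hq
  obtain ⟨P, Δ, hΔ, hP⟩ := exists_common_denominator (coord_s0OfResidues_mem_regularFun (q := q) hM)
  obtain ⟨Δ', hΔ', hF'⟩ := exists_eval_ne_zero_imp_of_mem_regularAt hF hF₀
  refine ⟨fun v => P v * Δ', Δ * Δ', by simp [hΔ, hΔ'], fun d' hE hres hne => ?_⟩
  rw [map_mul] at hne
  have hd' := hE.admissible hres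
  have hMd' := hMC ⟨d', hE⟩ hd' (hF' ⟨d', hE⟩ (right_ne_zero_of_mul hne))
  refine ⟨_, hd'.isE8_s0OfResidues hq hMd', (isS0_iff hq0 hq1 hd').2 ⟨_, hMd', rfl⟩, fun v => ?_⟩
  rw [map_mul, map_mul, eq_div_iff hne, ← mul_assoc]
  exact congrArg (· * _) (hP v ⟨d', hE⟩)

end QE8

end

theorem proposition4p4_general (q : ℂ) (hq0 : 0 < ‖q‖) (hq1 : ‖q‖ < 1) (d : QE8.QSystem)
    (hd : d.Admissible) :
    ((∃ b, QE8.IsS0 q d b) ∧ (∀ b, QE8.IsS0 q d b → b.IsE8) ∧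
      ∀ d' b b', d.Conj d' → QE8.IsS0 q d b → QE8.IsS0 q d' b' → b.Conj b') ∧
    (∀ i : Fin 8, i ≠ 2 →
      (∃ a, QE8.IsS0 q (d.swap i) a) ∧
      ∀ a b, QE8.IsS0 q (d.swap i) a → QE8.IsS0 q d b → a.Conj (b.swap i)) ∧
    (∀ b, QE8.IsS0 q d b → (∃ c, QE8.IsS0 q b c) ∧
      ((QE8.Star fun i => (d.residue q i).toLin') →
        (QE8.StarStar fun i => (d.residue q i).toLin') → ∀ c, QE8.IsS0 q b c → c.Conj d)) ∧
    (QE8.S0RationalAt q d ∧ ∀ b, QE8.IsS0 q d b → QE8.S0RationalAt q b) := by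
  have hswap (i : Fin 8) (hi : i ≠ 2) (j : Fin 9) :
      (Equiv.swap i.castSucc i.succ j : ℕ) < 3 ↔ (j : ℕ) < 3 := by
    revert i j
    decide
  exact ⟨⟨QE8.exists_isS0 hq0 hq1 hd, fun b hb => (hb.admissible hq0 hq1 hd).isE8,
    fun d' b b' h hb hb' => hb.conj_relabel hq0 hq1 hd (π := 1) (fun _ => Iff.rfl) h hb'⟩,
    fun i hi => ⟨QE8.exists_isS0 hq0 hq1 (hd.relabel (hswap i hi)), fun a b ha hb =>
      (hb.conj_relabel hq0 hq1 hd (hswap i hi) (.refl _) ha).symm⟩,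
    fun b hb => ⟨QE8.exists_isS0 hq0 hq1 (hb.admissible hq0 hq1 hd),
      fun hstar hstarstar c hc => hb.conj_symm hq0 hq1 hd hstar hstarstar hc⟩,
    hd.s0RationalAt hq0 hq1, fun b hb => (hb.admissible hq0 hq1 hd).s0RationalAt hq0 hq1⟩

theorem proposition4p4 (q : ℂ) (hq0 : 0 < ‖q‖) (hq1 : ‖q‖ < 1)
    (d : QE8.QSystem) (hd : d.IsE8) (hres : d.NonResonant)
    (B : Fin 3 → Matrix (Fin 3) (Fin 3) ℂ) (hB : QE8.IsResidueTuple q d B)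
    (hstar : QE8.Star fun i => Matrix.toLin' (B i))
    (hstarstar : QE8.StarStar fun i => Matrix.toLin' (B i)) :
    -- `s_0 . A` exists as a system of the same kind, and depends only on the class of `A`
    ((∃ b, QE8.IsS0 q d b) ∧ (∀ b, QE8.IsS0 q d b → b.IsE8) ∧
      ∀ d' b b', d.Conj d' → QE8.IsS0 q d b → QE8.IsS0 q d' b' → b.Conj b') ∧
    -- `s_0 . s_i . A ≃ s_i . s_0 . A` for `i = 1, …, 8`, `i ≠ 3` (here `i` is shifted by one)
    (∀ i : Fin 8, i ≠ 2 →
      (∃ a, QE8.IsS0 q (d.swap i) a) ∧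
      ∀ a b, QE8.IsS0 q (d.swap i) a → QE8.IsS0 q d b → a.Conj (b.swap i)) ∧
    -- `s_0 . s_0 . A ≃ A`
    (∀ b, QE8.IsS0 q d b → (∃ c, QE8.IsS0 q b c) ∧ ∀ c, QE8.IsS0 q b c → c.Conj d) ∧
    -- `s_0` is rational at `A`, and its inverse up to conjugation is rational at `s_0 . A`
    (QE8.S0RationalAt q d ∧ ∀ b, QE8.IsS0 q d b → QE8.S0RationalAt q b) := by
  obtain rfl := (hd.isResidueTuple_iff_eq_residue hq1).1 hB
  obtain ⟨hexists, hswap, hinv, hrational⟩ :=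
    proposition4p4_general q hq0 hq1 d (hd.admissible hres)
  exact ⟨hexists, hswap, fun b hb => (hinv b hb).imp_right fun h => h hstar hstarstar, hrational⟩
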